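/- Let $G$ be a finite group and $p$ a prime. A $p$-local subgroup of $G$ is the normalizer $N_G(P)$ of a nontrivial $p$-subgroup $P\le G$. For a finite group $H$, let $O_p(H)$ be its largest normal $p$-subgroup; $H$ has characteristic $p$ if $C_H(O_p(H))\le O_p(H)$. The group $G$ has parabolic characteristic $p$ if every $p$-local subgroup of $G$ that contains a Sylow $p$-subgroup of $G$ has characteristic $p$. An element of order $p$ in $G$ is $p$-central if it lies in the center of some Sylow $p$-subgroup of $G$; let $\Gamma_p(G)$ be the set of $p$-central elements. Let $\mathcal S_p(G)$ be the set of nontrivial $p$-subgroups of $G$. For $P\in\mathcal S_p(G)$ put $\widehat P=\langle x \mid x\in\Omega_1 Z(P)\cap\Gamma_p(G)\rangle$, where $\Omega_1 Z(P)$ is the subgroup generated by the elements of order $p$ in the center $Z(P)$, and set $$\widehat{\mathcal S}_p(G)=\{P\in\mathcal S_p(G)\mid \widehat P\neq 1\},\qquad \widetilde{\mathcal S}_p(G)=\{P\in\mathcal S_p(G)\mid P\cap\Gamma_p(G)\neq\emptyset\}.$$ Then $\widehat{\mathcal S}_p(G)\subseteq\widetilde{\mathcal S}_p(G)$; both are partially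 ordered by inclusion, and $G$ acts on them by conjugation. For a finite $G$-poset $\mathcal C$ let $|\mathcal C|$ be the geometric realization of the simplicial complex whose simplices are the nonempty chains in $\mathcal C$, with the induced action of $G$. If $G$ has parabolic characteristic $p$, then the inclusion $\widehat{\mathcal S}_p(G)\hookrightarrow\widetilde{\mathcal S}_p(G)$ is a $G$-homotopy equivalence; that is, the induced map $i\colon|\widehat{\mathcal S}_p(G)|\to|\widetilde{\mathcal S}_p(G)|$ is $G$-equivariant, and there is a continuous $G$-equivariant map $h\colon|\widetilde{\mathcal S}_p(G)|\to|\widehat{\mathcal S}_p(G)|$ such that $h\circ i$ and $i\circ h$ are homotopic to the respective identity maps through homotopies that are $G$-equivariant at every time. -/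

import Mathlib

open scoped Pointwise

noncomputable section

namespace PSubgroupCollections

/-! ### Geometric realization of the nerve of a finite poset -/

section OrderComplex

/-- The geometric realization `|X|` of the nerve of a finite poset `X`: the simplicial complex whose
vertices are the elements of `X` and whose simplices are the nonempty chains of `X`. A point is a
system of barycentric coordinates on `X` that is supported on a chain; the topology is the
one induced from `X → ℝ`, as usual for a finite simplicial complex. -/
def Realization (X : Type*) [PartialOrder X] [Fintype X] : Type _ :=
  {w : stdSimplex ℝ X // IsChain (· ≤ ·) {x | w x ≠ 0}}

variable {X Y Z : Type*} [PartialOrder X] [Fintype X] [PartialOrder Y] [Fintype Y]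
  [PartialOrder Z] [Fintype Z]

instance instTopologicalSpaceRealization : TopologicalSpace (Realization X) :=
  inferInstanceAs (TopologicalSpace {w : stdSimplex ℝ X // IsChain (· ≤ ·) {x | w x ≠ 0}})

theorem isChain_support_map (f : X →o Y) (w : stdSimplex ℝ X)
    (hw : IsChain (· ≤ ·) {x | w x ≠ 0}) :
    IsChain (· ≤ ·) {y | stdSimplex.map f w y ≠ 0} := by
  classical
  have key : ∀ y, stdSimplex.map f w y ≠ 0 → ∃ x, w x ≠ 0 ∧ f x = y := by
    intro y hy
    rw [stdSimplex.map_coe, FunOnFinite.linearMap_apply_apply] at hy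
    obtain ⟨x, hx, hne⟩ := Finset.exists_ne_zero_of_sum_ne_zero hy
    exact ⟨x, hne, by simpa using hx⟩
  intro a ha b hb _
  obtain ⟨x, hx, rfl⟩ := key a ha
  obtain ⟨y, hy, rfl⟩ := key b hb
  rcases hw.total hx hy with h | h
  · exact Or.inl (f.monotone h)
  · exact Or.inr (f.monotone h)

/-- The continuous map `|f| : |X| → |Y|` induced by a poset map `f`: it is affine on
simplices and sends the vertex `x` to the vertex `f x`. -/
def Realization.map (f : X →o Y) : C(Realization X, Realization Y) where
  toFun w := ⟨stdSimplex.map f w.1, isChain_support_map f w.1 w.2⟩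
  continuous_toFun :=
    ((stdSimplex.continuous_map f).comp continuous_subtype_val).subtype_mk _

theorem Realization.map_id (w : Realization X) : Realization.map OrderHom.id w = w :=
  Subtype.ext (stdSimplex.map_id_apply w.1)

theorem Realization.map_map (f : X →o Y) (g : Y →o Z) (w : Realization X) :
    Realization.map g (Realization.map f w) = Realization.map (g.comp f) w :=
  Subtype.ext (stdSimplex.map_comp_apply f g w.1)

/-- The action of an element `g` on a `G`-poset, as a poset map. -/
def smulOrderHom {G : Type*} [Group G] (X : Type*) [PartialOrder X] [MulAction G X]
    [CovariantClass G X (· • ·) (· ≤ ·)] (g : G) : X →o X where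
  toFun x := g • x
  monotone' _ _ h := CovariantClass.elim g h

/-- The realization of a `G`-poset is a `G`-space. -/
instance instMulActionRealization {G : Type*} [Group G] [MulAction G X] [CovariantClass G X (· • ·) (· ≤ ·)] :
    MulAction G (Realization X) where
  smul g w := Realization.map (smulOrderHom X g) w
  one_smul w := by
    have h : smulOrderHom X (1 : G) = OrderHom.id := OrderHom.ext _ _ (funext fun x => one_smul G x)
    change Realization.map (smulOrderHom X (1 : G)) w = w
    rw [h, Realization.map_id]
  mul_smul g h w := by
    have e : smulOrderHom X (g * h) = (smulOrderHom X g).comp (smulOrderHom X h) :=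
      OrderHom.ext _ _ (funext fun x => mul_smul g h x)
    change Realization.map (smulOrderHom X (g * h)) w =
      Realization.map (smulOrderHom X g) (Realization.map (smulOrderHom X h) w)
    rw [e, Realization.map_map]

end OrderComplex

/-! ### Equivariant homotopy equivalences -/

section Equivariant

/-- `f₀, f₁ : A → B` are `G`-homotopic: there is a homotopy `F : [0,1] × A → B` from `f₀` to `f₁`
with `F (t, g • a) = g • F (t, a)`. -/
def GHomotopic (G : Type*) [Group G] {A B : Type*} [TopologicalSpace A] [TopologicalSpace B]
    [MulAction G A] [MulAction G B] (f₀ f₁ : C(A, B)) : Prop :=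
  ∃ F : f₀.Homotopy f₁, ∀ (g : G) (t : unitInterval) (a : A), F (t, g • a) = g • F (t, a)

/-- A continuous map of `G`-spaces is a `G`-homotopy equivalence if it is `G`-equivariant and has a
`G`-equivariant homotopy inverse, the two homotopies being `G`-homotopies. -/
def IsGHomotopyEquiv (G : Type*) [Group G] {A B : Type*} [TopologicalSpace A] [TopologicalSpace B]
    [MulAction G A] [MulAction G B] (f : C(A, B)) : Prop :=
  (∀ (g : G) (a : A), f (g • a) = g • f a) ∧
    ∃ h : C(B, A), (∀ (g : G) (b : B), h (g • b) = g • h b) ∧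
      GHomotopic G (h.comp f) (ContinuousMap.id A) ∧
      GHomotopic G (f.comp h) (ContinuousMap.id B)

end Equivariant

/-! ### Groups of characteristic `p` and of parabolic characteristic `p` -/

section Characteristic

/-- `O_p(H)`, the largest normal `p`-subgroup of a finite group `H`, as the subgroup generated by all
normal `p`-subgroups of `H`. -/
def pRadical (p : ℕ) (H : Type*) [Group H] : Subgroup H :=
  sSup {N : Subgroup H | N.Normal ∧ IsPGroup p N}

/-- `H` has characteristic `p`: `C_H(O_p(H)) ≤ O_p(H)`. -/
def HasCharacteristic (p : ℕ) (H : Type*) [Group H] : Prop :=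
  Subgroup.centralizer (pRadical p H : Set H) ≤ pRadical p H

variable {G : Type*} [Group G]

/-- A `p`-local subgroup is the normalizer of a nontrivial `p`-subgroup. -/
def IsPLocal (p : ℕ) (H : Subgroup G) : Prop :=
  ∃ P : Subgroup G, IsPGroup p P ∧ P ≠ ⊥ ∧ H = Subgroup.normalizer (P : Set G)

/-- A parabolic subgroup is one that contains a Sylow `p`-subgroup of `G`. -/
def IsParabolic (p : ℕ) (H : Subgroup G) : Prop :=
  ∃ S : Sylow p G, (S : Subgroup G) ≤ H

/-- `G` has parabolic characteristic `p`: all `p`-local parabolic subgroups of `G` have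
characteristic `p`. -/
def HasParabolicCharacteristic (p : ℕ) (G : Type*) [Group G] : Prop :=
  ∀ H : Subgroup G, IsPLocal p H → IsParabolic p H → HasCharacteristic p H

end Characteristic

/-! ### `p`-central elements -/

section PCentral

variable {G : Type*} [Group G]

/-- The center `Z(P)` of a subgroup `P` of `G`, as a subgroup of `G`. -/
def centerOf (P : Subgroup G) : Subgroup G := (Subgroup.center P).map P.subtype

/-- `Ω₁(A)`, the subgroup generated by the elements of order `p` of `A`. -/
def omegaOne (p : ℕ) (A : Subgroup G) : Subgroup G :=
  Subgroup.closure {x | x ∈ A ∧ orderOf x = p}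

/-- `Γ_p(G)`: the elements of order `p` that lie in the center of a Sylow `p`-subgroup of `G`. -/
def pCentral (p : ℕ) (G : Type*) [Group G] : Set G :=
  {x | orderOf x = p ∧ ∃ S : Sylow p G, x ∈ centerOf (S : Subgroup G)}

/-- The subgroup of `P` generated by the `p`-central elements of `G` in `Ω₁ Z(P)`. -/
def hatSubgroup (p : ℕ) (P : Subgroup G) : Subgroup G :=
  Subgroup.closure {x | x ∈ omegaOne p (centerOf P) ∧ x ∈ pCentral p G}

theorem mem_centerOf {P : Subgroup G} {x : G} :
    x ∈ centerOf P ↔ x ∈ P ∧ ∀ y ∈ P, y * x = x * y := by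
  simp only [centerOf, Subgroup.mem_map, Subgroup.mem_center_iff, Subgroup.coe_subtype]
  constructor
  · rintro ⟨z, hz, rfl⟩
    exact ⟨z.2, fun y hy => congrArg Subtype.val (hz ⟨y, hy⟩)⟩
  · rintro ⟨hx, h⟩
    exact ⟨⟨x, hx⟩, fun y => Subtype.ext (h y.1 y.2), rfl⟩

theorem orderOf_mulAut (φ : MulAut G) (x : G) : orderOf (φ x) = orderOf x :=
  orderOf_injective φ.toMonoidHom φ.injective x

theorem centerOf_smul (φ : MulAut G) (P : Subgroup G) :
    centerOf (φ • P) = φ • centerOf P := by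
  ext x
  simp only [mem_centerOf, Subgroup.mem_pointwise_smul_iff_inv_smul_mem, MulAut.smul_def]
  refine and_congr_right fun _ => ⟨fun h y hy => ?_, fun h y hy => ?_⟩
  · have := congrArg (φ⁻¹ : MulAut G) (h (φ y) (by simpa using hy))
    simpa using this
  · have := congrArg φ (h (φ⁻¹ y) hy)
    simpa using this

theorem closure_smul (φ : MulAut G) (s : Set G) :
    φ • Subgroup.closure s = Subgroup.closure {x | φ⁻¹ x ∈ s} := by
  have h : {x | φ⁻¹ x ∈ s} = φ • s := by
    ext x
    rw [Set.mem_smul_set_iff_inv_smul_mem]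
    rfl
  rw [h, Subgroup.smul_closure]

theorem omegaOne_smul (p : ℕ) (φ : MulAut G) (A : Subgroup G) :
    omegaOne p (φ • A) = φ • omegaOne p A := by
  simp only [omegaOne, closure_smul, Subgroup.mem_pointwise_smul_iff_inv_smul_mem, MulAut.smul_def,
    Set.mem_ofPred_eq, orderOf_mulAut]

theorem conj_mem_pCentral {p : ℕ} (g : G) {x : G} (hx : x ∈ pCentral p G) :
    MulAut.conj g x ∈ pCentral p G := by
  obtain ⟨ho, S, hS⟩ := hx
  refine ⟨by rw [orderOf_mulAut, ho], g • S, ?_⟩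
  have : ((g • S : Sylow p G) : Subgroup G) = MulAut.conj g • (S : Subgroup G) := rfl
  rw [this, centerOf_smul]
  exact Subgroup.smul_mem_pointwise_smul _ (MulAut.conj g) _ hS

theorem conj_inv_mem_pCentral {p : ℕ} (g : G) (x : G) :
    (MulAut.conj g)⁻¹ x ∈ pCentral p G ↔ x ∈ pCentral p G := by
  constructor
  · intro h
    have h' := conj_mem_pCentral g h
    rwa [← MulAut.mul_apply, mul_inv_cancel, MulAut.one_apply] at h'
  · intro h
    rw [← map_inv]
    exact conj_mem_pCentral g⁻¹ h

theorem hatSubgroup_conj (p : ℕ) (g : G) (P : Subgroup G) :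
    hatSubgroup p (MulAut.conj g • P) = MulAut.conj g • hatSubgroup p P := by
  simp only [hatSubgroup, centerOf_smul, omegaOne_smul, closure_smul,
    Subgroup.mem_pointwise_smul_iff_inv_smul_mem, MulAut.smul_def, Set.mem_ofPred_eq,
    conj_inv_mem_pCentral]

theorem omegaOne_le (p : ℕ) (A : Subgroup G) : omegaOne p A ≤ A :=
  (Subgroup.closure_le A).2 fun _ hx => hx.1

theorem centerOf_le (P : Subgroup G) : centerOf P ≤ P := fun _ hx => (mem_centerOf.1 hx).1

end PCentral

/-! ### Collections of `p`-subgroups -/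

section Collections

/-- A collection of `p`-subgroups of `G`: a set of `p`-subgroups closed under conjugation. -/
structure PCollection (p : ℕ) (G : Type*) [Group G] where
  carrier : Set (Subgroup G)
  isPGroup : ∀ P ∈ carrier, IsPGroup p P
  conj_mem : ∀ (g : G), ∀ P ∈ carrier, MulAut.conj g • P ∈ carrier

variable {p : ℕ} {G : Type*} [Group G]

/-- The members of a collection, partially ordered by inclusion. -/
abbrev PCollection.Elem (C : PCollection p G) : Type _ := {P : Subgroup G // P ∈ C.carrier}

instance instFintypeElem (C : PCollection p G) [Finite G] : Fintype C.Elem := Fintype.ofFinite _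

/-- The conjugation action of `G` on a collection, `g • P = g P g⁻¹`. -/
instance instMulActionElem (C : PCollection p G) : MulAction G C.Elem where
  smul g P := ⟨MulAut.conj g • P.1, C.conj_mem g P.1 P.2⟩
  one_smul P := Subtype.ext (by
    change MulAut.conj (1 : G) • P.1 = P.1
    rw [map_one, one_smul])
  mul_smul g h P := Subtype.ext (by
    change MulAut.conj (g * h) • P.1 = MulAut.conj g • MulAut.conj h • P.1
    rw [map_mul, mul_smul])

instance instCovariantClassElem (C : PCollection p G) :
    CovariantClass G C.Elem (· • ·) (· ≤ ·) where
  elim g _ _ h := (Subgroup.pointwise_smul_le_pointwise_smul_iff (a := MulAut.conj g)).2 h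

theorem isPGroup_conj {P : Subgroup G} (hP : IsPGroup p P) (g : G) :
    IsPGroup p (MulAut.conj g • P : Subgroup G) := hP.map _

/-- The Brown collection `S_p(G)` of all nontrivial `p`-subgroups of `G`. -/
def brown (p : ℕ) (G : Type*) [Group G] : PCollection p G where
  carrier := {P | IsPGroup p P ∧ P ≠ ⊥}
  isPGroup _ hP := hP.1
  conj_mem g P hP := ⟨isPGroup_conj hP.1 g, fun h => hP.2 (by
    rwa [← Subgroup.smul_bot (MulAut.conj g), smul_left_cancel_iff] at h)⟩

/-- The distinguished collection `Ĉ_p(G)`: the `P` in the collection with `P̂ ≠ 1`. -/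
def PCollection.hat (C : PCollection p G) : PCollection p G where
  carrier := {P | P ∈ C.carrier ∧ hatSubgroup p P ≠ ⊥}
  isPGroup P hP := C.isPGroup P hP.1
  conj_mem g P hP := ⟨C.conj_mem g P hP.1, fun h => hP.2 (by
    rwa [hatSubgroup_conj, ← Subgroup.smul_bot (MulAut.conj g), smul_left_cancel_iff] at h)⟩

/-- The collection `C̃_p(G)`: the `P` in the collection that contain a `p`-central element. -/
def PCollection.tilde (C : PCollection p G) : PCollection p G where
  carrier := {P | P ∈ C.carrier ∧ ((P : Set G) ∩ pCentral p G).Nonempty}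
  isPGroup P hP := C.isPGroup P hP.1
  conj_mem g P hP := ⟨C.conj_mem g P hP.1, by
    obtain ⟨x, hx, hx'⟩ := hP.2
    exact ⟨MulAut.conj g x, Subgroup.smul_mem_pointwise_smul _ (MulAut.conj g) _ hx,
      conj_mem_pCentral g hx'⟩⟩

theorem PCollection.hat_subset_tilde (C : PCollection p G) :
    C.hat.carrier ⊆ C.tilde.carrier := by
  rintro P ⟨hP, hne⟩
  refine ⟨hP, ?_⟩
  by_contra hempty
  refine hne (Subgroup.closure_eq_bot_iff.2 fun x hx => ?_)
  exact (hempty ⟨x, centerOf_le P (omegaOne_le p _ hx.1), hx.2⟩).elim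

/-- The inclusion of one collection into another, as a poset map. -/
def PCollection.inclusion {C D : PCollection p G} (h : C.carrier ⊆ D.carrier) :
    C.Elem →o D.Elem where
  toFun P := ⟨P.1, h P.2⟩
  monotone' _ _ hPQ := hPQ

end Collections

end PSubgroupCollections

end

/-! Write Y for the poset of `p`-subgroups containing a `p`-central element. The members P with P̂ =
1 are pushed off |Y| equivariantly, one order at a time in increasing order, using that the upper
link Y_{>P} of such a P is conically contractible: with R = O_p(N_G(P)), every Q > P satisfies Q ≥
N_Q(P) ≤ N_Q(P)R ≥ R. All these groups contain P properly: N_Q(P) because normalizers grow in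
`p`-groups, and R because R̂ ≠ 1 (`radicalOf_mem_hat`), whereas P̂ = 1.

The group theory behind R̂ ≠ 1 is that N_G(P) has characteristic `p` as soon as P contains a
`p`-central z (`hasCharacteristic_normalizer_of_mem_pCentral`). This holds for ⟨z⟩ by hypothesis and
climbs from A to B when A ≤ B ≤ N_G(A), by Thompson's A × B lemma. If S is a Sylow group containing
R, then Z(S) centralizes R, hence lies in R, and its elements of order `p` lie in R̂.

The topology is made explicit. A point of |Y| with mass at an undistinguished P is deformed by
draining P while its mass above P slides along the zigzag (`ConicalContraction.moved`). The
construction uses no choices, so it is continuous and equivariant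
(`ConicalContraction.exists_isGDeformation`). Mass only moves to strictly larger groups, so members
cleared earlier stay cleared, and points supported on the distinguished collection never move. -/

noncomputable section

namespace PSubgroupCollections

/-! ### Thompson's A × B lemma -/

section CoprimeAction

/-- Thompson's `A × B` lemma: a `p'`-automorphism `x` of a `p`-group `U` that commutes with a
`p`-group `B` of automorphisms and fixes `C_U(B)` pointwise is trivial. -/
theorem mulAut_eq_one_of_fixes_fixedPoints {p : ℕ} [Fact p.Prime] {U : Type*} [Group U] [Finite U]
    (hU : IsPGroup p U) {B : Subgroup (MulAut U)} (hB : IsPGroup p B) {x : MulAut U}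
    (hxB : ∀ b ∈ B, Commute b x) (hx : (orderOf x).Coprime p)
    (hfix : ∀ u : U, (∀ b ∈ B, b u = u) → x u = u) : x = 1 := by
  let V : Subgroup U := x.toMonoidHom.eqLocus (MonoidHom.id U)
  have memV : ∀ u, u ∈ V ↔ x u = u := fun u => Iff.rfl
  have xb : ∀ b ∈ B, ∀ u, x (b u) = b (x u) := fun b hb u =>
    (congrArg (fun f : MulAut U => f u) (hxB b hb)).symm
  suffices hV : V = ⊤ by
    ext u
    exact (memV u).1 (hV ▸ Subgroup.mem_top u)
  by_contra hV
  have : MulAction.QuotientAction B V := ⟨fun b u u' h => by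
    rw [memV] at h ⊢
    change x ((b.1 u)⁻¹ * b.1 u') = (b.1 u)⁻¹ * b.1 u'
    rw [← map_inv, ← map_mul, xb b.1 b.2, h]⟩
  have hdvd : p ∣ Nat.card (U ⧸ V) := by
    obtain ⟨n, hn⟩ := hU.index V
    rw [← Subgroup.index_eq_card, hn]
    refine dvd_pow_self p fun h0 => hV ?_
    rwa [h0, pow_zero, Subgroup.index_eq_one] at hn
  -- `B` acts on the cosets of `V = C_U(x)` and fixes `V` itself; since `p` divides their number, it
  -- fixes another coset.
  obtain ⟨q, hq, hne⟩ := hB.exists_fixed_point_of_prime_dvd_card_of_fixed_point (U ⧸ V) hdvd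
    (a := ((1 : U) : U ⧸ V)) (fun b => by
      rw [MulAction.Quotient.smul_coe, smul_one])
  induction q using QuotientGroup.induction_on with
  | H u =>
    have hu : u ∉ V := fun h => hne ((QuotientGroup.eq).2 (by simpa using h))
    have hb : ∀ b ∈ B, x (u⁻¹ * b u) = u⁻¹ * b u := fun b hb => by
      have := hq ⟨b, hb⟩
      rw [MulAction.Quotient.smul_coe] at this
      exact (memV _).1 ((QuotientGroup.eq).1 this.symm)
    -- Each `b` replaces `u` by `u * v` with `v` fixed by `x`, which leaves `x u * u⁻¹` unchanged.
    -- So `d` is fixed by `B`, hence by `x`, and iterating `x` on `u` multiplies by powers of `d`.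
    set d := x u * u⁻¹ with hd
    have hxd : x d = d := hfix d fun b hbB => by
      have h1 := hb b hbB
      have h2 : b u = u * (u⁻¹ * b u) := by group
      rw [hd, map_mul, map_inv, ← xb b hbB, h2, map_mul, h1]
      group
    have hpow : ∀ n : ℕ, (x ^ n) u = d ^ n * u := by
      intro n
      induction n with
      | zero => simp
      | succ n ih =>
        rw [pow_succ', MulAut.mul_apply, ih, map_mul, map_pow, hxd, pow_succ, hd]
        group
    have h1 : d ^ orderOf x = 1 := by
      have := hpow (orderOf x)
      rw [pow_orderOf_eq_one, MulAut.one_apply] at this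
      exact mul_eq_right.1 this.symm
    have h2 : d = 1 := by
      by_contra hd1
      have := (hU.dvd_orderOf hd1).trans (orderOf_dvd_of_pow_eq_one h1)
      exact (Fact.out : p.Prime).one_lt.ne' (Nat.dvd_one.1 (hx ▸ Nat.dvd_gcd this dvd_rfl))
    exact hu ((memV u).2 (mul_inv_eq_one.1 h2))

/-- The `A × B` lemma for subgroups of a group. -/
theorem commute_of_commute_centralizer {p : ℕ} [Fact p.Prime] {G : Type*} [Group G] [Finite G]
    {U B : Subgroup G} (hU : IsPGroup p U) (hB : IsPGroup p B)
    (hBU : B ≤ Subgroup.normalizer (U : Set G)) {x : G} (hxU : x ∈ Subgroup.normalizer (U : Set G))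
    (hxB : ∀ b ∈ B, b * x = x * b) (hx : (orderOf x).Coprime p)
    (hfix : ∀ u ∈ U, (∀ b ∈ B, b * u = u * b) → x * u = u * x) :
    ∀ u ∈ U, x * u = u * x := by
  let φ := U.normalizerMonoidHom
  have hφ : φ ⟨x, hxU⟩ = 1 := by
    refine mulAut_eq_one_of_fixes_fixedPoints hU
      (B := (B.subgroupOf (Subgroup.normalizer (U : Set G))).map φ)
      (hB.comap_subtype.map φ) ?_ ?_ ?_
    · rintro _ ⟨b, hb, rfl⟩
      have : Commute b ⟨x, hxU⟩ := Subtype.ext (hxB b.1 hb)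
      exact this.map φ
    · refine Nat.Coprime.coprime_dvd_left (orderOf_map_dvd φ _) ?_
      rwa [Subgroup.orderOf_mk]
    · intro u hu
      refine Subtype.ext ?_
      change x * u.1 * x⁻¹ = u.1
      rw [mul_inv_eq_iff_eq_mul]
      refine hfix u.1 u.2 fun b hb => ?_
      have := congrArg Subtype.val (hu _ ⟨⟨b, hBU hb⟩, hb, rfl⟩)
      change b * u.1 * b⁻¹ = u.1 at this
      rwa [mul_inv_eq_iff_eq_mul] at this
  intro u hu
  have := congrArg Subtype.val (congrArg (fun f : MulAut U => f ⟨u, hu⟩) hφ)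
  change x * u * x⁻¹ = u at this
  rwa [mul_inv_eq_iff_eq_mul] at this

/-- Raising an element to the `p`-part of its order leaves an element of order prime to `p`. -/
theorem isPGroup_of_coprime_eq_one {p : ℕ} [Fact p.Prime] {G : Type*} [Group G] [Finite G]
    (h : ∀ x : G, (orderOf x).Coprime p → x = 1) : IsPGroup p G := by
  intro g
  obtain ⟨k, m, hm, hk⟩ := Nat.exists_eq_pow_mul_and_not_dvd (orderOf_pos g).ne' p
    (Fact.out : p.Prime).ne_one
  refine ⟨k, h _ ?_⟩
  have hdvd : p ^ k ∣ orderOf g := hk ▸ Dvd.intro _ rfl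
  rw [orderOf_pow_of_dvd (pow_ne_zero _ (Fact.out : p.Prime).ne_zero) hdvd, hk,
    Nat.mul_div_cancel_left _ (pow_pos (Fact.out : p.Prime).pos _)]
  exact (((Fact.out : p.Prime).coprime_iff_not_dvd).2 hm).symm

end CoprimeAction

/-! ### O_p(H) inside the ambient group -/

section Radical

variable {G : Type*} [Group G] {p : ℕ}

/-- `O_p(H)` as a subgroup of the ambient group. -/
def radicalOf (p : ℕ) (H : Subgroup G) : Subgroup G := (pRadical p H).map H.subtype

theorem radicalOf_le (H : Subgroup G) : radicalOf p H ≤ H := Subgroup.map_subtype_le _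

theorem isPGroup_pRadical (p : ℕ) (H : Type*) [Group H] : IsPGroup p (pRadical p H) :=
  Sylow.sSup_of_normal _ (fun _ h => h.2) fun _ h => h.1

theorem isPGroup_radicalOf (p : ℕ) (H : Subgroup G) : IsPGroup p (radicalOf p H) :=
  (isPGroup_pRadical p H).map _

theorem pRadical_normal (p : ℕ) (H : Type*) [Group H] : (pRadical p H).Normal :=
  Subgroup.sSup_normal _ fun _ h => h.1

theorem conj_mem_radicalOf {H : Subgroup G} {h x : G} (hh : h ∈ H) (hx : x ∈ radicalOf p H) :
    h * x * h⁻¹ ∈ radicalOf p H := by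
  obtain ⟨y, hy, rfl⟩ := hx
  exact ⟨⟨h, hh⟩ * y * ⟨h, hh⟩⁻¹, (pRadical_normal p H).conj_mem y hy ⟨h, hh⟩, rfl⟩

theorem le_normalizer_of_conj_mem {H K : Subgroup G} (h : ∀ g ∈ H, ∀ x ∈ K, g * x * g⁻¹ ∈ K) :
    H ≤ Subgroup.normalizer (K : Set G) := fun g hg => Subgroup.mem_normalizer_iff.2 fun x =>
  ⟨h g hg x, fun hx => by simpa [mul_assoc] using h g⁻¹ (inv_mem hg) _ hx⟩

theorem le_normalizer_radicalOf (H : Subgroup G) :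
    H ≤ Subgroup.normalizer (radicalOf p H : Set G) :=
  le_normalizer_of_conj_mem fun _ hg _ hx => conj_mem_radicalOf hg hx

theorem le_radicalOf {H K : Subgroup G} (hKH : K ≤ H) (hK : IsPGroup p K)
    (hHK : H ≤ Subgroup.normalizer (K : Set G)) : K ≤ radicalOf p H := by
  rw [← Subgroup.map_subgroupOf_eq_of_le hKH]
  refine Subgroup.map_mono (le_sSup ⟨?_, hK.comap_subtype⟩)
  exact (Subgroup.normal_subgroupOf_iff_le_normalizer hKH).2 hHK

theorem hasCharacteristic_iff {H : Subgroup G} : HasCharacteristic p H ↔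
    ∀ x ∈ H, (∀ r ∈ radicalOf p H, r * x = x * r) → x ∈ radicalOf p H := by
  constructor
  · intro h x hx hr
    refine ⟨⟨x, hx⟩, h (Subgroup.mem_centralizer_iff.2 fun r hr' => Subtype.ext ?_), rfl⟩
    exact hr r.1 ⟨r, hr', rfl⟩
  · intro h x hx
    obtain ⟨y, hy, hyx⟩ := h x.1 x.2 (by
      rintro _ ⟨r, hr, rfl⟩
      exact congrArg Subtype.val (Subgroup.mem_centralizer_iff.1 hx r hr))
    rwa [Subtype.ext hyx] at hy

theorem pRadical_map_equiv {H K : Type*} [Group H] [Group K] (e : H ≃* K) :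
    (pRadical p H).map e.toMonoidHom = pRadical p K := by
  refine le_antisymm (le_sSup ⟨(pRadical_normal p _).map _ e.surjective,
    (isPGroup_pRadical p _).map _⟩) ?_
  rw [Subgroup.map_equiv_eq_comap_symm', ← Subgroup.map_le_iff_le_comap]
  exact le_sSup ⟨(pRadical_normal p _).map _ e.symm.surjective, (isPGroup_pRadical p _).map _⟩

theorem radicalOf_smul (φ : MulAut G) (H : Subgroup G) :
    radicalOf p (φ • H) = φ • radicalOf p H := by
  rw [radicalOf, ← pRadical_map_equiv (Subgroup.equivSMul φ H), Subgroup.map_map]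
  exact (Subgroup.map_map (pRadical p H) φ.toMonoidHom H.subtype).symm

theorem mem_normalizer_iff_smul {K : Subgroup G} {g : G} :
    g ∈ Subgroup.normalizer (K : Set G) ↔ MulAut.conj g • K = K := by
  constructor
  · intro h
    ext x
    rw [Subgroup.mem_pointwise_smul_iff_inv_smul_mem, ← map_inv, MulAut.smul_def, MulAut.conj_apply,
      inv_inv]
    have := Subgroup.mem_normalizer_iff.1 h (g⁻¹ * x * g)
    rw [this]
    group
  · intro h
    refine Subgroup.mem_normalizer_iff.2 fun x => ?_
    conv_rhs => rw [← h, Subgroup.mem_pointwise_smul_iff_inv_smul_mem, ← map_inv, MulAut.smul_def,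
      MulAut.conj_apply]
    group

/-- O_p(H) is characteristic in H, so it is normalized by whatever normalizes H. -/
theorem radicalOf_le_radicalOf {H K : Subgroup G} (hHK : H ≤ K)
    (hK : K ≤ Subgroup.normalizer (H : Set G)) : radicalOf p H ≤ radicalOf p K :=
  le_radicalOf ((radicalOf_le H).trans hHK) (isPGroup_radicalOf p H) fun g hg => by
    rw [mem_normalizer_iff_smul, ← radicalOf_smul, mem_normalizer_iff_smul.1 (hK hg)]

end Radical

/-! ### Local subgroups of characteristic `p` -/

section LocalCharacteristic

variable {G : Type*} [Group G] {p : ℕ}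

theorem normalizer_smul (φ : MulAut G) (P : Subgroup G) :
    Subgroup.normalizer ((φ • P : Subgroup G) : Set G) = φ • Subgroup.normalizer (P : Set G) := by
  ext g
  rw [Subgroup.mem_pointwise_smul_iff_inv_smul_mem, Subgroup.mem_normalizer_iff,
    Subgroup.mem_normalizer_iff]
  simp only [Subgroup.mem_pointwise_smul_iff_inv_smul_mem]
  constructor
  · intro h x
    simpa [MulAut.smul_def] using h (φ x)
  · intro h x
    simpa [MulAut.smul_def] using h (φ⁻¹ x)

theorem le_radicalOf_normalizer {P : Subgroup G} (hP : IsPGroup p P) :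
    P ≤ radicalOf p (Subgroup.normalizer (P : Set G)) :=
  le_radicalOf Subgroup.le_normalizer hP le_rfl

theorem lt_inf_normalizer [Finite G] [Fact p.Prime] {P Q : Subgroup G} (hQ : IsPGroup p Q)
    (h : P < Q) : P < Q ⊓ Subgroup.normalizer (P : Set G) := by
  refine lt_of_le_not_ge (le_inf h.le Subgroup.le_normalizer) fun hle => ?_
  have : Group.IsNilpotent Q := hQ.isNilpotent
  have hlt := Group.normalizerCondition_of_isNilpotent (G := Q) (P.subgroupOf Q)
    (lt_top_iff_ne_top.2 fun ht => h.not_ge (Subgroup.subgroupOf_eq_top.1 ht))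
  refine hlt.not_ge fun x hx => ?_
  refine hle ⟨x.2, Subgroup.mem_normalizer_iff.2 fun y => ?_⟩
  by_cases hy : y ∈ Q
  · exact Subgroup.mem_normalizer_iff.1 hx ⟨y, hy⟩
  -- The normalizer taken inside `Q` tests only elements of `Q`; for `y` outside `Q` neither `y` nor
  -- its conjugate can lie in `P`.
  · refine iff_of_false (fun h' => hy (h.le h')) fun h' => hy ?_
    have := Q.mul_mem (Q.mul_mem (Q.inv_mem x.2) (h.le h')) x.2
    simpa [mul_assoc] using this

/-- Let U = O_p(N(A)) and M = N(B). Since C(B) ≤ N(A), the group C_U(B) is a normal `p`-subgroup of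
C(B), which is normal in M; hence C_U(B) ≤ O_p(M). A `p'`-element centralizing O_p(M) therefore
centralizes both B and C_U(B), so by the A × B lemma it centralizes U. It then lies in U and is
trivial. Thus C_M(O_p(M)) is a normal `p`-subgroup of M. -/
theorem hasCharacteristic_normalizer_of_le_normalizer [Finite G] [Fact p.Prime] {A B : Subgroup G}
    (hAB : A ≤ B) (hBA : B ≤ Subgroup.normalizer (A : Set G)) (hB : IsPGroup p B)
    (hA : HasCharacteristic p (Subgroup.normalizer (A : Set G))) :
    HasCharacteristic p (Subgroup.normalizer (B : Set G)) := by
  rw [hasCharacteristic_iff] at hA ⊢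
  set H := Subgroup.normalizer (A : Set G)
  set M := Subgroup.normalizer (B : Set G)
  have hCA : Subgroup.centralizer (B : Set G) ≤ H :=
    (Subgroup.centralizer_le (Set.Subset.trans hAB subset_rfl)).trans
      (Subgroup.centralizer_le_normalizer _)
  have hCM : radicalOf p (Subgroup.centralizer (B : Set G)) ≤ radicalOf p M := by
    refine radicalOf_le_radicalOf (Subgroup.centralizer_le_normalizer _)
      (le_normalizer_of_conj_mem fun g hg x hx => Subgroup.mem_centralizer_iff.2 fun b hb => ?_)
    have h1 := Subgroup.mem_centralizer_iff.1 hx (g⁻¹ * b * g)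
      ((Subgroup.mem_normalizer_iff''.1 hg b).1 hb)
    have := congrArg (fun y => g * y * g⁻¹) h1
    simpa [mul_assoc] using this
  have hUC : radicalOf p H ⊓ Subgroup.centralizer (B : Set G) ≤ radicalOf p M := by
    refine le_trans (le_radicalOf inf_le_right (isPGroup_radicalOf p H).to_inf_left
      (le_normalizer_of_conj_mem fun g hg x hx => ⟨conj_mem_radicalOf (hCA hg) hx.1, ?_⟩)) hCM
    exact mul_mem (mul_mem hg hx.2) (Subgroup.inv_mem _ hg)
  let C := M ⊓ Subgroup.centralizer (radicalOf p M : Set G)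
  have hBR : B ≤ radicalOf p M := le_radicalOf_normalizer hB
  have hC : IsPGroup p C := by
    refine isPGroup_of_coprime_eq_one fun x hx => Subtype.ext ?_
    have hx' : (orderOf x.1).Coprime p := by rwa [Subgroup.orderOf_coe]
    have hxr : ∀ r ∈ radicalOf p M, r * x.1 = x.1 * r := Subgroup.mem_centralizer_iff.1 x.2.2
    have hxH : x.1 ∈ H := hCA (Subgroup.mem_centralizer_iff.2 fun b hb => hxr b (hBR hb))
    have hcomm := commute_of_commute_centralizer (isPGroup_radicalOf p H) hB
      (hBA.trans (le_normalizer_radicalOf H)) (le_normalizer_radicalOf H hxH)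
      (fun b hb => hxr b (hBR hb)) hx' fun u hu hub =>
        (hxr u (hUC ⟨hu, Subgroup.mem_centralizer_iff.2 hub⟩)).symm
    have hxU := hA x.1 hxH fun r hr => (hcomm r hr).symm
    by_contra hne
    have hd := (isPGroup_radicalOf p H).dvd_orderOf (g := ⟨x.1, hxU⟩)
      fun h => hne (congrArg (fun y : radicalOf p H => y.1) h)
    rw [Subgroup.orderOf_mk] at hd
    exact (Fact.out : p.Prime).one_lt.ne' (Nat.dvd_one.1 (hx' ▸ Nat.dvd_gcd hd dvd_rfl))
  intro x hx hr
  refine le_radicalOf (H := M) (K := C) inf_le_left hC ?_ ⟨hx, Subgroup.mem_centralizer_iff.2 hr⟩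
  refine le_normalizer_of_conj_mem fun g hg y hy =>
    ⟨mul_mem (mul_mem hg hy.1) (Subgroup.inv_mem _ hg), Subgroup.mem_centralizer_iff.2 fun r hr => ?_⟩
  have hr' : g⁻¹ * r * g ∈ radicalOf p M := by
    simpa using conj_mem_radicalOf (inv_mem hg) hr
  have := congrArg (fun y => g * y * g⁻¹) (Subgroup.mem_centralizer_iff.1 hy.2 _ hr')
  simpa [mul_assoc] using this

/-- A Sylow group with `z` in its center normalizes ⟨z⟩, so this local subgroup is parabolic. The
assumption on `G` is applied only here. -/
theorem hasCharacteristic_normalizer_zpowers [Fact p.Prime] (hG : HasParabolicCharacteristic p G)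
    {z : G} (hz : z ∈ pCentral p G) :
    HasCharacteristic p (Subgroup.normalizer (Subgroup.zpowers z : Set G)) := by
  obtain ⟨ho, S, hS⟩ := hz
  refine hG _ ⟨_, IsPGroup.of_card (n := 1) (by rw [Nat.card_zpowers, ho, pow_one]), ?_, rfl⟩ ⟨S, ?_⟩
  · rw [Ne, Subgroup.zpowers_eq_bot]
    rintro rfl
    exact (Fact.out : p.Prime).one_lt.ne (by rwa [orderOf_one] at ho)
  · refine le_trans ?_ (Subgroup.centralizer_le_normalizer _)
    refine fun s hs => Subgroup.mem_centralizer_iff.2 ?_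
    rintro _ ⟨n, rfl⟩
    have : Commute z s := ((mem_centerOf.1 hS).2 s hs).symm
    exact this.zpow_left n

/-- Climb from ⟨z⟩ to `P`: a maximal `A ≤ P` whose normalizer has characteristic `p` must be `P`,
since otherwise N_P(A) is larger and inherits the property. -/
theorem hasCharacteristic_normalizer_of_mem_pCentral [Finite G] [Fact p.Prime]
    (hG : HasParabolicCharacteristic p G) {P : Subgroup G} (hP : IsPGroup p P) {z : G} (hzP : z ∈ P)
    (hz : z ∈ pCentral p G) : HasCharacteristic p (Subgroup.normalizer (P : Set G)) := by
  obtain ⟨A, ⟨hAP, hA⟩, hmax⟩ := (Set.toFinite {A : Subgroup G | A ≤ P ∧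
    HasCharacteristic p (Subgroup.normalizer (A : Set G))}).exists_maximal
    ⟨_, Subgroup.zpowers_le.2 hzP, hasCharacteristic_normalizer_zpowers hG hz⟩
  rcases hAP.eq_or_lt with rfl | hlt
  · exact hA
  · have h := lt_inf_normalizer hP hlt
    exact (h.not_ge (hmax ⟨inf_le_left, hasCharacteristic_normalizer_of_le_normalizer h.le
      inf_le_right hP.to_inf_left hA⟩ h.le)).elim

/-- If `P` contains a `p`-central element, then `O_p(N_G(P))` lies in the distinguished Brown
collection. -/
theorem radicalOf_mem_hat [Finite G] [Fact p.Prime] (hG : HasParabolicCharacteristic p G)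
    {P : Subgroup G} (hP : P ∈ (brown p G).tilde.carrier) :
    radicalOf p (Subgroup.normalizer (P : Set G)) ∈ (brown p G).hat.carrier := by
  obtain ⟨⟨hPp, hP1⟩, z, hzP, hz⟩ := hP
  set R := radicalOf p (Subgroup.normalizer (P : Set G))
  have hPR : P ≤ R := le_radicalOf_normalizer hPp
  have hR : IsPGroup p R := isPGroup_radicalOf p _
  refine ⟨⟨hR, fun h => hP1 (le_bot_iff.1 (h ▸ hPR))⟩, ?_⟩
  obtain ⟨S, hRS⟩ := hR.exists_le_sylow
  have hS1 : Nontrivial S :=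
    (Subgroup.nontrivial_iff_ne_bot _).2 fun h => hP1 (le_bot_iff.1 (h ▸ hPR.trans hRS))
  have hZ := S.isPGroup'.center_nontrivial
  have hdvd : p ∣ Nat.card (Subgroup.center S) :=
    ((S.isPGroup'.to_subgroup _).card_eq_or_dvd).resolve_left
      (Finite.one_lt_card_iff_nontrivial.2 hZ).ne'
  obtain ⟨y, hy⟩ := exists_prime_orderOf_dvd_card' p hdvd
  have hyo : orderOf (y : S).1 = p := by
    rw [Subgroup.orderOf_coe, Subgroup.orderOf_coe, hy]
  have hyS : (y : S).1 ∈ centerOf (S : Subgroup G) := ⟨y, y.2, rfl⟩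
  have hcomm := (mem_centerOf.1 hyS).2
  -- `y` centralizes `S ≥ R ≥ P`, so it lies in N_G(P) and centralizes its radical `R`;
  -- characteristic `p` puts it into `R`.
  have hyR : (y : S).1 ∈ R := by
    refine hasCharacteristic_iff.1 (hasCharacteristic_normalizer_of_mem_pCentral hG hPp hzP hz) _
      ?_ fun r hr => hcomm r (hRS hr)
    exact Subgroup.centralizer_le_normalizer _
      (Subgroup.mem_centralizer_iff.2 fun x hx => hcomm x (hRS (hPR hx)))
  intro hbot
  have h1 := Subgroup.closure_eq_bot_iff.1 hbot (show (y : S).1 ∈ _ from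
    ⟨Subgroup.subset_closure ⟨mem_centerOf.2 ⟨hyR, fun r hr => hcomm r (hRS hr)⟩, hyo⟩,
      hyo, S, hyS⟩)
  rw [Set.mem_singleton_iff.1 h1, orderOf_one] at hyo
  exact (Fact.out : p.Prime).one_lt.ne hyo

end LocalCharacteristic

/-! ### Barycentric coordinates on the realization -/

section Coordinates

variable {Y : Type*} [PartialOrder Y] [Fintype Y]

/-- The barycentric coordinates of a point of `|Y|`. -/
def Realization.coord (w : Realization Y) (x : Y) : ℝ := w.1 x

namespace Realization

theorem coord_nonneg (w : Realization Y) (x : Y) : 0 ≤ w.coord x := w.1.2.1 x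

theorem sum_coord (w : Realization Y) : ∑ x, w.coord x = 1 := w.1.2.2

theorem isChain_coord (w : Realization Y) : IsChain (· ≤ ·) {x | w.coord x ≠ 0} := w.2

theorem ext_coord {v w : Realization Y} (h : ∀ x, v.coord x = w.coord x) : v = w :=
  Subtype.ext (stdSimplex.ext (funext h))

theorem continuous_coord : Continuous (coord : Realization Y → Y → ℝ) :=
  continuous_subtype_val.comp continuous_subtype_val

theorem continuous_of_coord {T : Type*} [TopologicalSpace T] {f : T → Realization Y}
    (h : ∀ x, Continuous fun t => (f t).coord x) : Continuous f :=
  Continuous.subtype_mk (Continuous.subtype_mk (continuous_pi h) fun t => (f t).1.2) fun t =>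
    (f t).2

theorem coord_map_of_injective {X : Type*} [PartialOrder X] [Fintype X] (f : X →o Y)
    (hf : Function.Injective f) (w : Realization X) (x : X) :
    (Realization.map f w).coord (f x) = w.coord x := by
  classical
  change stdSimplex.map f w.1 (f x) = w.1 x
  rw [stdSimplex.map_coe, FunOnFinite.linearMap_apply_apply, Finset.sum_eq_single x]
  · intro y hy hne
    exact (hne (hf (by simpa using hy))).elim
  · intro h
    simp at h

theorem coord_map_eq_zero {X : Type*} [PartialOrder X] [Fintype X] (f : X →o Y)
    (w : Realization X) {y : Y} (hy : ∀ x, f x ≠ y) : (Realization.map f w).coord y = 0 := by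
  classical
  change stdSimplex.map f w.1 y = 0
  rw [stdSimplex.map_coe, FunOnFinite.linearMap_apply_apply]
  refine Finset.sum_eq_zero fun x hx => (hy x (by simpa using hx)).elim

theorem coord_smul {G : Type*} [Group G] [MulAction G Y] [CovariantClass G Y (· • ·) (· ≤ ·)]
    (g : G) (w : Realization Y) (x : Y) : (g • w).coord (g • x) = w.coord x :=
  coord_map_of_injective (smulOrderHom Y g) (MulAction.injective g) w x

/-- The point of `|Y|` with given homogeneous coordinates. -/
def ofWeights (f : Y → ℝ) (h0 : ∀ x, 0 ≤ f x) (hpos : 0 < ∑ x, f x)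
    (hc : IsChain (· ≤ ·) {x | f x ≠ 0}) : Realization Y :=
  ⟨⟨fun x => f x / ∑ y, f y, fun x => div_nonneg (h0 x) hpos.le, by
    rw [← Finset.sum_div, div_self hpos.ne']⟩, by
    refine hc.mono ?_
    intro x hx hfx
    refine hx ?_
    change f x / _ = 0
    rw [hfx, zero_div]⟩

end Realization

end Coordinates

/-! ### Schedules for moving mass along a chain -/

section Transfer

/-- The part of a mass `a` that has been moved at time `s`. -/
def transfer (a s : ℝ) : ℝ := max 0 (min a s)

theorem transfer_nonneg (a s : ℝ) : 0 ≤ transfer a s := le_max_left _ _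

theorem transfer_le {a : ℝ} (ha : 0 ≤ a) (s : ℝ) : transfer a s ≤ a := max_le ha (min_le_left _ _)

theorem transfer_of_nonpos {a s : ℝ} (hs : s ≤ 0) : transfer a s = 0 :=
  max_eq_left ((min_le_right _ _).trans hs)

theorem transfer_of_le {a s : ℝ} (ha : 0 ≤ a) (h : a ≤ s) : transfer a s = a := by
  rw [transfer, min_eq_left h, max_eq_right ha]

theorem pos_of_transfer_ne_zero {a s : ℝ} (h : transfer a s ≠ 0) : 0 < s :=
  not_le.1 fun hs => h (transfer_of_nonpos hs)

variable {Y : Type*} [PartialOrder Y] [Fintype Y] {w : Y → ℝ} {P Q Q' : Y} {s : ℝ}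

open Classical in
/-- The mass of `w` on `Y_{>P}`. -/
def massAbove (w : Y → ℝ) (P : Y) : ℝ := ∑ Q, if P < Q then w Q else 0

open Classical in
/-- The mass of `w` on the open interval `(P, Q)`. -/
def massBetween (w : Y → ℝ) (P Q : Y) : ℝ := ∑ Q', if P < Q' ∧ Q' < Q then w Q' else 0

/-- The mass moved away from `Q` at time `s`, when the mass on `Y_{>P}` is moved from below. -/
def moveLow (w : Y → ℝ) (P : Y) (s : ℝ) (Q : Y) : ℝ := transfer (w Q) (s - massBetween w P Q)

/-- The mass moved away from `Q` at time `s`, when mass is moved from above. -/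
def moveUp (w : Y → ℝ) (s : ℝ) (Q : Y) : ℝ := transfer (w Q) (s - massAbove w Q)

theorem massAbove_nonneg (hw : ∀ x, 0 ≤ w x) (P : Y) : 0 ≤ massAbove w P :=
  Finset.sum_nonneg fun x _ => by split_ifs <;> simp [hw]

theorem massBetween_nonneg (hw : ∀ x, 0 ≤ w x) (P Q : Y) : 0 ≤ massBetween w P Q :=
  Finset.sum_nonneg fun x _ => by split_ifs <;> simp [hw]

theorem add_massAbove_le (hw : ∀ x, 0 ≤ w x) (h : P < Q) : w Q + massAbove w Q ≤ massAbove w P := by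
  classical
  rw [massAbove, massAbove, ← Finset.sum_erase_add _ _ (Finset.mem_univ Q), if_neg (lt_irrefl Q),
    add_zero, ← Finset.sum_erase_add _ _ (Finset.mem_univ Q), if_pos h, add_comm]
  gcongr with x hx
  split_ifs with h1 h2
  · exact le_rfl
  · exact (h2 (h.trans h1)).elim
  · exact hw x
  · exact le_rfl

theorem add_massBetween_le_massAbove (hw : ∀ x, 0 ≤ w x) (h : P < Q) :
    w Q + massBetween w P Q ≤ massAbove w P := by
  classical
  rw [massAbove, massBetween, ← Finset.sum_erase_add _ _ (Finset.mem_univ Q),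
    if_neg (fun h => lt_irrefl Q h.2),
    add_zero, ← Finset.sum_erase_add _ _ (Finset.mem_univ Q), if_pos h, add_comm]
  gcongr with x hx
  split_ifs with h1 h2 h2
  · exact le_rfl
  · exact (h2 h1.1).elim
  · exact hw x
  · exact le_rfl

theorem add_massBetween_le (hw : ∀ x, 0 ≤ w x) (h : P < Q) (h' : Q < Q') :
    w Q + massBetween w P Q ≤ massBetween w P Q' := by
  classical
  rw [massBetween, massBetween, ← Finset.sum_erase_add _ _ (Finset.mem_univ Q),
    if_neg (fun h => lt_irrefl Q h.2),
    add_zero, ← Finset.sum_erase_add _ _ (Finset.mem_univ Q), if_pos ⟨h, h'⟩, add_comm]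
  gcongr with x hx
  split_ifs with h1 h2 h2
  · exact le_rfl
  · exact (h2 ⟨h1.1, h1.2.trans h'⟩).elim
  · exact hw x
  · exact le_rfl

theorem moveLow_nonneg : 0 ≤ moveLow w P s Q := transfer_nonneg _ _

theorem moveUp_nonneg : 0 ≤ moveUp w s Q := transfer_nonneg _ _

theorem moveLow_le (hw : ∀ x, 0 ≤ w x) : moveLow w P s Q ≤ w Q := transfer_le (hw Q) _

theorem moveUp_le (hw : ∀ x, 0 ≤ w x) : moveUp w s Q ≤ w Q := transfer_le (hw Q) _

theorem moveLow_of_nonpos (hw : ∀ x, 0 ≤ w x) (hs : s ≤ 0) : moveLow w P s Q = 0 :=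
  transfer_of_nonpos (by linarith [massBetween_nonneg hw P Q])

theorem moveUp_of_nonpos (hw : ∀ x, 0 ≤ w x) (hs : s ≤ 0) : moveUp w s Q = 0 :=
  transfer_of_nonpos (by linarith [massAbove_nonneg hw Q])

/-- The waiting time of `Q` plus its own mass is at most the total mass above `P`, so each phase
lasts no longer than that total. -/
theorem moveLow_of_le (hw : ∀ x, 0 ≤ w x) (h : P < Q) (hs : massAbove w P ≤ s) :
    moveLow w P s Q = w Q :=
  transfer_of_le (hw Q) (by linarith [add_massBetween_le_massAbove hw h])

theorem moveUp_of_le (hw : ∀ x, 0 ≤ w x) (h : P < Q) (hs : massAbove w P ≤ s) :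
    moveUp w s Q = w Q :=
  transfer_of_le (hw Q) (by linarith [add_massAbove_le hw h])

/-- The mass of `Q` counts towards the waiting time of `Q'`, so `Q'` starts only after `Q` is
finished. -/
theorem moveLow_eq_of_lt (hw : ∀ x, 0 ≤ w x) (h : P < Q) (h' : Q < Q')
    (hQ' : moveLow w P s Q' ≠ 0) : moveLow w P s Q = w Q :=
  transfer_of_le (hw Q) (by
    linarith [add_massBetween_le hw h h', pos_of_transfer_ne_zero hQ'])

theorem moveUp_eq_of_lt (hw : ∀ x, 0 ≤ w x) (h' : Q < Q') (hQ : moveUp w s Q ≠ 0) :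
    moveUp w s Q' = w Q' :=
  transfer_of_le (hw Q') (by linarith [add_massAbove_le hw h', pos_of_transfer_ne_zero hQ])

/-- The second phase starts when the first is complete. This makes the mass waiting at `N P Q` in
`moved` nonnegative. -/
theorem moveUp_le_moveLow (hw : ∀ x, 0 ≤ w x) {Q : Y} (h : P < Q) :
    moveUp w (s - massAbove w P) Q ≤ moveLow w P s Q := by
  rcases le_total s (massAbove w P) with ht | ht
  · rw [moveUp_of_nonpos hw (by linarith)]
    exact moveLow_nonneg
  · rw [moveLow_of_le hw h ht]
    exact moveUp_le hw

theorem continuous_transfer {T : Type*} [TopologicalSpace T] {a s : T → ℝ} (ha : Continuous a)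
    (hs : Continuous s) : Continuous fun t => transfer (a t) (s t) :=
  continuous_const.max (ha.min hs)

theorem continuous_massAbove (P : Y) : Continuous fun w : Y → ℝ => massAbove w P := by
  unfold massAbove
  refine continuous_finsetSum _ fun x _ => ?_
  split_ifs <;> fun_prop

theorem continuous_massBetween (P Q : Y) : Continuous fun w : Y → ℝ => massBetween w P Q := by
  unfold massBetween
  refine continuous_finsetSum _ fun x _ => ?_
  split_ifs <;> fun_prop

end Transfer

/-! ### Pushing mass off an antichain -/

/-- A conical contraction `Q ≥ N Q ≤ M Q ≥ R` of `Y_{>P}`, for every `P` in `O`. -/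
structure ConicalContraction {Y : Type*} [PartialOrder Y] (O : Set Y) where
  N : Y → Y → Y
  M : Y → Y → Y
  R : Y → Y
  lt_N : ∀ P ∈ O, ∀ Q, P < Q → P < N P Q
  N_le : ∀ P ∈ O, ∀ Q, P < Q → N P Q ≤ Q
  N_le_M : ∀ P ∈ O, ∀ Q, P < Q → N P Q ≤ M P Q
  R_le_M : ∀ P ∈ O, ∀ Q, P < Q → R P ≤ M P Q
  lt_R : ∀ P ∈ O, P < R P
  N_mono : ∀ P ∈ O, ∀ Q Q', P < Q → Q ≤ Q' → N P Q ≤ N P Q'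
  M_mono : ∀ P ∈ O, ∀ Q Q', P < Q → Q ≤ Q' → M P Q ≤ M P Q'

namespace ConicalContraction

variable {Y : Type*} [PartialOrder Y] [Fintype Y] {O : Set Y} (D : ConicalContraction O)
  {w : Y → ℝ} {P : Y} {s t : ℝ}

open Classical in
/-- The weight of `x` after the part of `w` on `Y_{>P}`, together with a mass at `P` as far as `t`
exceeds twice the mass on `Y_{>P}`, has been moved along the contraction up to time `t`. -/
def moved (w : Y → ℝ) (P : Y) (t : ℝ) (x : Y) : ℝ :=
  (∑ Q, if P < Q then
    (if Q = x then w Q - moveLow w P t Q else 0) +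
    (if D.N P Q = x then moveLow w P t Q - moveUp w (t - massAbove w P) Q else 0) +
    (if D.M P Q = x then moveUp w (t - massAbove w P) Q else 0) else 0) +
  if D.R P = x then max 0 (t - 2 * massAbove w P) else 0

open Classical in
/-- Homogeneous coordinates of the deformation at time `s` of the point with coordinates `w`. -/
def deform (w : Y → ℝ) (s : ℝ) (x : Y) : ℝ :=
  w x + ∑ P, if P ∈ O then
    D.moved w P (s * w P) x - (if P < x then w x else 0) - (if P = x then s * w P else 0) else 0

theorem moved_nonneg (hw : ∀ x, 0 ≤ w x) (x : Y) : 0 ≤ D.moved w P t x := by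
  refine add_nonneg (Finset.sum_nonneg fun Q _ => ?_) ?_
  · by_cases h : P < Q
    · rw [if_pos h]
      have h1 := moveUp_le_moveLow (s := t) hw h
      have h2 := moveLow_le (P := P) (s := t) (Q := Q) hw
      have h3 := moveUp_nonneg (w := w) (s := t - massAbove w P) (Q := Q)
      refine add_nonneg (add_nonneg ?_ ?_) ?_ <;> split_ifs <;> linarith
    · rw [if_neg h]
  · split_ifs
    · exact le_max_left _ _
    · exact le_rfl

theorem moved_ne_zero {x : Y} (h : D.moved w P t x ≠ 0) :
    (∃ Q, P < Q ∧ x = Q ∧ w Q - moveLow w P t Q ≠ 0) ∨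
    (∃ Q, P < Q ∧ x = D.N P Q ∧ moveLow w P t Q - moveUp w (t - massAbove w P) Q ≠ 0) ∨
    (∃ Q, P < Q ∧ x = D.M P Q ∧ moveUp w (t - massAbove w P) Q ≠ 0) ∨
    (x = D.R P ∧ 2 * massAbove w P < t) := by
  classical
  by_contra! hc
  obtain ⟨h1, h2, h3, h4⟩ := hc
  refine h ?_
  rw [moved, Finset.sum_eq_zero, zero_add]
  · split_ifs with hx
    · exact max_eq_left (by linarith [h4 hx.symm])
    · rfl
  · intro Q _
    by_cases hQ : P < Q
    · rw [if_pos hQ]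
      have e1 := h1 Q hQ
      have e2 := h2 Q hQ
      have e3 := h3 Q hQ
      rw [ite_eq_right_iff.2 fun h => e1 h.symm, ite_eq_right_iff.2 fun h => e2 h.symm,
        ite_eq_right_iff.2 fun h => e3 h.symm, add_zero, add_zero]
    · rw [if_neg hQ]

theorem lt_of_moved_ne_zero (hP : P ∈ O) {x : Y} (h : D.moved w P t x ≠ 0) : P < x := by
  rcases D.moved_ne_zero h with ⟨Q, hQ, rfl, -⟩ | ⟨Q, hQ, rfl, -⟩ | ⟨Q, hQ, rfl, -⟩ | ⟨rfl, -⟩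
  · exact hQ
  · exact D.lt_N P hP Q hQ
  · exact (D.lt_N P hP Q hQ).trans_le (D.N_le_M P hP Q hQ)
  · exact D.lt_R P hP

/-- With b the mass above `P`, times up to b move `Q` to `N P Q`, times from b to 2b move `N P Q` to
`M P Q`, and later times add mass at `R P`. The direction in which the chain is traversed is chosen
in each phase so that moved and unmoved vertices stay comparable. -/
theorem isChain_moved (hw : ∀ x, 0 ≤ w x) (hc : IsChain (· ≤ ·) {x | w x ≠ 0}) (hP : P ∈ O) :
    IsChain (· ≤ ·) {x | D.moved w P t x ≠ 0} := by
  have hb := massAbove_nonneg hw P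
  intro x hx y hy _
  have hx := D.moved_ne_zero hx
  have hy := D.moved_ne_zero hy
  clear * - hw hc hP hx hy hb
  rcases le_or_gt t (massAbove w P) with ht | ht
  · have key : ∀ z, ((∃ Q, P < Q ∧ z = Q ∧ w Q - moveLow w P t Q ≠ 0) ∨
      (∃ Q, P < Q ∧ z = D.N P Q ∧ moveLow w P t Q - moveUp w (t - massAbove w P) Q ≠ 0) ∨
      (∃ Q, P < Q ∧ z = D.M P Q ∧ moveUp w (t - massAbove w P) Q ≠ 0) ∨
      (z = D.R P ∧ 2 * massAbove w P < t)) → (P < z ∧ w z ≠ moveLow w P t z ∧ w z ≠ 0) ∨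
        ∃ Q, P < Q ∧ z = D.N P Q ∧ moveLow w P t Q ≠ 0 ∧ w Q ≠ 0 := by
      have h0 : ∀ Q, moveUp w (t - massAbove w P) Q = 0 := fun Q =>
        moveUp_of_nonpos hw (by linarith)
      have h1 : ∀ Q, w Q = 0 → moveLow w P t Q = 0 := fun Q hQ =>
        le_antisymm (hQ ▸ moveLow_le hw) moveLow_nonneg
      rintro z (⟨Q, hQ, rfl, h⟩ | ⟨Q, hQ, rfl, h⟩ | ⟨Q, hQ, rfl, h⟩ | ⟨rfl, h⟩)
      · refine Or.inl ⟨hQ, sub_ne_zero.1 h, fun h' => h ?_⟩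
        rw [h', h1 _ h', sub_zero]
      · rw [h0, sub_zero] at h
        exact Or.inr ⟨Q, hQ, rfl, h, fun h' => h (h1 Q h')⟩
      · exact (h (h0 Q)).elim
      · linarith
    -- Moving from below: a moved `Q'` lies below or at an unfinished `Q`, whence `N P Q' ≤ Q' ≤ Q`.
    have mixed : ∀ Q Q', P < Q → w Q ≠ moveLow w P t Q → w Q ≠ 0 → P < Q' →
        moveLow w P t Q' ≠ 0 → w Q' ≠ 0 → D.N P Q' ≤ Q := by
      intro Q Q' hQ hQ1 hQ2 hQ' hQ1' hQ2'
      refine (D.N_le P hP Q' hQ').trans ?_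
      rcases hc.total hQ2 hQ2' with h | h
      · rcases h.eq_or_lt with rfl | h
        · exact le_rfl
        · exact (hQ1 (moveLow_eq_of_lt hw hQ h hQ1').symm).elim
      · exact h
    rcases key x hx with ⟨hx1, hx2, hx3⟩ | ⟨Q, hQ1, rfl, hQ2, hQ3⟩ <;>
      rcases key y hy with ⟨hy1, hy2, hy3⟩ | ⟨Q', hQ1', rfl, hQ2', hQ3'⟩
    · exact hc.total hx3 hy3
    · exact Or.inr (mixed _ _ hx1 hx2 hx3 hQ1' hQ2' hQ3')
    · exact Or.inl (mixed _ _ hy1 hy2 hy3 hQ1 hQ2 hQ3)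
    · exact (hc.total hQ3 hQ3').imp (D.N_mono P hP _ _ hQ1) (D.N_mono P hP _ _ hQ1')
  have hlow : ∀ Q, P < Q → moveLow w P t Q = w Q := fun Q hQ => moveLow_of_le hw hQ ht.le
  rcases le_or_gt t (2 * massAbove w P) with ht' | ht'
  · have key : ∀ z, ((∃ Q, P < Q ∧ z = Q ∧ w Q - moveLow w P t Q ≠ 0) ∨
      (∃ Q, P < Q ∧ z = D.N P Q ∧ moveLow w P t Q - moveUp w (t - massAbove w P) Q ≠ 0) ∨
      (∃ Q, P < Q ∧ z = D.M P Q ∧ moveUp w (t - massAbove w P) Q ≠ 0) ∨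
      (z = D.R P ∧ 2 * massAbove w P < t)) →
        (∃ Q, P < Q ∧ z = D.N P Q ∧ w Q ≠ moveUp w (t - massAbove w P) Q ∧ w Q ≠ 0) ∨
        ∃ Q, P < Q ∧ z = D.M P Q ∧ moveUp w (t - massAbove w P) Q ≠ 0 ∧ w Q ≠ 0 := by
      have h1 : ∀ Q, w Q = 0 → moveUp w (t - massAbove w P) Q = 0 := fun Q hQ =>
        le_antisymm (hQ ▸ moveUp_le hw) moveUp_nonneg
      rintro z (⟨Q, hQ, rfl, h⟩ | ⟨Q, hQ, rfl, h⟩ | ⟨Q, hQ, rfl, h⟩ | ⟨rfl, h⟩)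
      · exact (h (by rw [hlow _ hQ, sub_self])).elim
      · rw [hlow _ hQ] at h
        refine Or.inl ⟨Q, hQ, rfl, sub_ne_zero.1 h, fun h' => h ?_⟩
        rw [h', h1 _ h', sub_zero]
      · exact Or.inr ⟨Q, hQ, rfl, h, fun h' => h (h1 Q h')⟩
      · linarith
    -- Moving from above: an unfinished `Q` lies below or at a moved `Q'`, whence `N P Q ≤ N P Q' ≤
    -- M P Q'`.
    have mixed : ∀ Q Q', P < Q → w Q ≠ moveUp w (t - massAbove w P) Q → w Q ≠ 0 → P < Q' →
        moveUp w (t - massAbove w P) Q' ≠ 0 → w Q' ≠ 0 → D.N P Q ≤ D.M P Q' := by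
      intro Q Q' hQ hQ1 hQ2 hQ' hQ1' hQ2'
      refine le_trans ?_ (D.N_le_M P hP Q' hQ')
      refine D.N_mono P hP _ _ hQ ?_
      rcases hc.total hQ2 hQ2' with h | h
      · exact h
      · rcases h.eq_or_lt with rfl | h
        · exact le_rfl
        · exact (hQ1 (moveUp_eq_of_lt hw h hQ1').symm).elim
    rcases key x hx with ⟨Q, hQ1, rfl, hQ2, hQ3⟩ | ⟨Q, hQ1, rfl, hQ2, hQ3⟩ <;>
      rcases key y hy with ⟨Q', hQ1', rfl, hQ2', hQ3'⟩ | ⟨Q', hQ1', rfl, hQ2', hQ3'⟩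
    · exact (hc.total hQ3 hQ3').imp (D.N_mono P hP _ _ hQ1) (D.N_mono P hP _ _ hQ1')
    · exact Or.inl (mixed _ _ hQ1 hQ2 hQ3 hQ1' hQ2' hQ3')
    · exact Or.inr (mixed _ _ hQ1' hQ2' hQ3' hQ1 hQ2 hQ3)
    · exact (hc.total hQ3 hQ3').imp (D.M_mono P hP _ _ hQ1) (D.M_mono P hP _ _ hQ1')
  -- Both phases are over, so only vertices `M P Q` and `R P` remain, and `R P` lies below all of
  -- the former.
  · have hup : ∀ Q, P < Q → moveUp w (t - massAbove w P) Q = w Q := fun Q hQ =>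
      moveUp_of_le hw hQ (by linarith)
    have key : ∀ z, ((∃ Q, P < Q ∧ z = Q ∧ w Q - moveLow w P t Q ≠ 0) ∨
      (∃ Q, P < Q ∧ z = D.N P Q ∧ moveLow w P t Q - moveUp w (t - massAbove w P) Q ≠ 0) ∨
      (∃ Q, P < Q ∧ z = D.M P Q ∧ moveUp w (t - massAbove w P) Q ≠ 0) ∨
      (z = D.R P ∧ 2 * massAbove w P < t)) →
        (∃ Q, P < Q ∧ z = D.M P Q ∧ w Q ≠ 0) ∨ z = D.R P := by
      rintro z (⟨Q, hQ, rfl, h⟩ | ⟨Q, hQ, rfl, h⟩ | ⟨Q, hQ, rfl, h⟩ | ⟨rfl, h⟩)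
      · exact (h (by rw [hlow _ hQ, sub_self])).elim
      · exact (h (by rw [hlow _ hQ, hup _ hQ, sub_self])).elim
      · exact Or.inl ⟨Q, hQ, rfl, hup Q hQ ▸ h⟩
      · exact Or.inr rfl
    rcases key x hx with ⟨Q, hQ1, rfl, hQ2⟩ | rfl <;>
      rcases key y hy with ⟨Q', hQ1', rfl, hQ2'⟩ | rfl
    · exact (hc.total hQ2 hQ2').imp (D.M_mono P hP _ _ hQ1) (D.M_mono P hP _ _ hQ1')
    · exact Or.inr (D.R_le_M P hP Q hQ1)
    · exact Or.inl (D.R_le_M P hP Q' hQ1')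
    · exact Or.inl le_rfl

theorem sum_moved : ∑ x, D.moved w P t x = massAbove w P + max 0 (t - 2 * massAbove w P) := by
  classical
  simp only [moved, Finset.sum_add_distrib, Finset.sum_ite_eq, Finset.mem_univ, if_true]
  rw [Finset.sum_comm]
  congr 1
  refine Finset.sum_congr rfl fun Q _ => ?_
  split_ifs
  · simp [Finset.sum_add_distrib]
  · simp

open Classical in
theorem moved_zero (hw : ∀ x, 0 ≤ w x) (x : Y) :
    D.moved w P 0 x = if P < x then w x else 0 := by
  have hb := massAbove_nonneg hw P
  have h1 : ∀ Q, moveLow w P 0 Q = 0 := fun Q => moveLow_of_nonpos hw le_rfl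
  have h2 : ∀ Q, moveUp w (0 - massAbove w P) Q = 0 := fun Q => moveUp_of_nonpos hw (by linarith)
  have h3 : max 0 (0 - 2 * massAbove w P) = 0 := max_eq_left (by linarith)
  simp only [moved, h1, h2, h3, sub_zero, ite_self, add_zero]
  rw [Finset.sum_eq_single x]
  · simp
  · intro Q _ hQ
    simp [hQ]
  · simp

/-- A summand with `w P = 0` runs its contraction only to time zero, where it returns exactly the
part above `P` that is subtracted. -/
theorem deform_eq (hw : ∀ x, 0 ≤ w x) (h0 : ∀ P ∈ O, w P = 0) (x : Y) : D.deform w s x = w x := by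
  classical
  rw [deform, Finset.sum_eq_zero, add_zero]
  intro P _
  by_cases h : P ∈ O
  · simp [h0 P h, D.moved_zero hw]
  · rw [if_neg h]

-- A chain meets an antichain at most once, so only one summand of `deform` contributes.
open Classical in
theorem deform_eq_of_ne_zero (hw : ∀ x, 0 ≤ w x) (hc : IsChain (· ≤ ·) {x | w x ≠ 0})
    (hO : IsAntichain (· ≤ ·) O) (hP : P ∈ O) (hwP : w P ≠ 0) (x : Y) :
    D.deform w s x = (if P < x then 0 else w x) - (if P = x then s * w P else 0) +
      D.moved w P (s * w P) x := by
  rw [deform, Finset.sum_eq_single P]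
  · rw [if_pos hP]
    split_ifs <;> ring
  · intro Q _ hne
    by_cases hQ : Q ∈ O
    · rw [if_pos hQ]
      have : w Q = 0 := by
        by_contra hwQ
        exact (hc.total hwP hwQ).elim (fun h => hne (hO.eq hP hQ h).symm)
          fun h => hne (hO.eq hQ hP h)
      simp [this, D.moved_zero hw]
    · rw [if_neg hQ]
  · simp

theorem sum_deform (hw : ∀ x, 0 ≤ w x) (hc : IsChain (· ≤ ·) {x | w x ≠ 0})
    (hO : IsAntichain (· ≤ ·) O) (hP : P ∈ O) (hwP : w P ≠ 0) :
    ∑ x, D.deform w s x = ∑ x, w x - s * w P + max 0 (s * w P - 2 * massAbove w P) := by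
  classical
  simp only [D.deform_eq_of_ne_zero hw hc hO hP hwP, Finset.sum_add_distrib,
    Finset.sum_sub_distrib, sum_moved, Finset.sum_ite_eq, Finset.mem_univ, if_true]
  have : ∑ x, w x = (∑ x, if P < x then 0 else w x) + massAbove w P := by
    rw [massAbove, ← Finset.sum_add_distrib]
    refine Finset.sum_congr rfl fun x _ => ?_
    split_ifs <;> simp
  rw [this]
  ring

theorem deform_nonneg (hw : ∀ x, 0 ≤ w x) (hc : IsChain (· ≤ ·) {x | w x ≠ 0})
    (hO : IsAntichain (· ≤ ·) O) (hs : s ≤ 1) (x : Y) : 0 ≤ D.deform w s x := by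
  classical
  by_cases h : ∃ P ∈ O, w P ≠ 0
  · obtain ⟨P, hP, hwP⟩ := h
    rw [D.deform_eq_of_ne_zero hw hc hO hP hwP]
    refine add_nonneg ?_ (D.moved_nonneg hw x)
    split_ifs with h1 h2 h2
    · exact (h1.ne h2).elim
    · simp
    · subst h2
      nlinarith [hw P]
    · simpa using hw x
  · push Not at h
    rw [D.deform_eq hw h]
    exact hw x

theorem deform_ne_zero (hw : ∀ x, 0 ≤ w x) (hc : IsChain (· ≤ ·) {x | w x ≠ 0})
    (hO : IsAntichain (· ≤ ·) O) (hP : P ∈ O) (hwP : w P ≠ 0) {x : Y} (h : D.deform w s x ≠ 0) :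
    (w x ≠ 0 ∧ x ≤ P ∧ (s = 1 → x ≠ P)) ∨ D.moved w P (s * w P) x ≠ 0 := by
  classical
  by_contra! hn
  obtain ⟨h1, h2⟩ := hn
  rw [D.deform_eq_of_ne_zero hw hc hO hP hwP, h2, add_zero] at h
  split_ifs at h with h3 h4 h4
  · exact (h3.ne h4).elim
  · simp at h
  · subst h4
    obtain ⟨h5, -⟩ := h1 hwP le_rfl
    rw [h5, one_mul, sub_self] at h
    exact h rfl
  · rw [sub_zero] at h
    rcases hc.total hwP h with h5 | h5
    · exact h3 (lt_of_le_of_ne h5 h4)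
    · exact h4 (h1 h h5).2.symm

/-- The surviving old vertices are at most `P` and the moved ones lie strictly above `P`, so two
chains are stacked. -/
theorem isChain_deform (hw : ∀ x, 0 ≤ w x) (hc : IsChain (· ≤ ·) {x | w x ≠ 0})
    (hO : IsAntichain (· ≤ ·) O) : IsChain (· ≤ ·) {x | D.deform w s x ≠ 0} := by
  by_cases h : ∃ P ∈ O, w P ≠ 0
  · obtain ⟨P, hP, hwP⟩ := h
    intro x hx y hy hxy
    rcases D.deform_ne_zero hw hc hO hP hwP hx with hx | hx <;>
      rcases D.deform_ne_zero hw hc hO hP hwP hy with hy | hy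
    · exact hc.total hx.1 hy.1
    · exact Or.inl (hx.2.1.trans (D.lt_of_moved_ne_zero hP hy).le)
    · exact Or.inr (hy.2.1.trans (D.lt_of_moved_ne_zero hP hx).le)
    · exact D.isChain_moved hw hc hP hx hy hxy
  · push Not at h
    simpa only [D.deform_eq hw h] using hc

theorem add_massAbove_le_sum (hw : ∀ x, 0 ≤ w x) (P : Y) : w P + massAbove w P ≤ ∑ x, w x := by
  classical
  rw [massAbove, ← Finset.sum_erase_add _ _ (Finset.mem_univ P), if_neg (lt_irrefl P), add_zero,
    ← Finset.sum_erase_add _ w (Finset.mem_univ P), add_comm]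
  gcongr with x
  split_ifs
  · exact le_rfl
  · exact hw x

/-- Draining `P` leaves at least `1 - s * w P`, which could vanish only for `w P = 1`. Then there is
no mass above `P`, and everything drained reappears at `R P`. This is why `moved` deposits mass
there. -/
theorem sum_deform_pos (hw : ∀ x, 0 ≤ w x) (hsum : ∑ x, w x = 1)
    (hc : IsChain (· ≤ ·) {x | w x ≠ 0}) (hO : IsAntichain (· ≤ ·) O) (hs : s ≤ 1) :
    0 < ∑ x, D.deform w s x := by
  by_cases h : ∃ P ∈ O, w P ≠ 0
  · obtain ⟨P, hP, hwP⟩ := h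
    rw [D.sum_deform hw hc hO hP hwP, hsum]
    have h1 := add_massAbove_le_sum hw P
    rw [hsum] at h1
    have h2 := massAbove_nonneg hw P
    have h3 := hw P
    have h4 : s * w P ≤ w P := mul_le_of_le_one_left h3 hs
    rcases (show w P ≤ 1 by linarith).eq_or_lt with h5 | h5
    · have := le_max_right 0 (s * w P - 2 * massAbove w P)
      linarith
    · have := le_max_left 0 (s * w P - 2 * massAbove w P)
      linarith
  · push Not at h
    simp only [D.deform_eq hw h, hsum, zero_lt_one]

end ConicalContraction

/-! ### Invariance under order automorphisms -/

section Equivariance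

variable {Y : Type*} [PartialOrder Y] [Fintype Y] {v w : Y → ℝ} {P Q : Y} {s t : ℝ} (e : Y ≃o Y)
  (hvw : ∀ x, v (e x) = w x)

include hvw

theorem massAbove_orderIso (P : Y) : massAbove v (e P) = massAbove w P := by
  classical
  rw [massAbove, massAbove, ← Equiv.sum_comp e.toEquiv]
  simp [hvw]

theorem massBetween_orderIso (P Q : Y) : massBetween v (e P) (e Q) = massBetween w P Q := by
  classical
  rw [massBetween, massBetween, ← Equiv.sum_comp e.toEquiv]
  simp [hvw]

theorem moveLow_orderIso : moveLow v (e P) s (e Q) = moveLow w P s Q := by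
  rw [moveLow, moveLow, hvw, massBetween_orderIso e hvw]

theorem moveUp_orderIso : moveUp v s (e Q) = moveUp w s Q := by
  rw [moveUp, moveUp, hvw, massAbove_orderIso e hvw]

namespace ConicalContraction

variable {O : Set Y} (D : ConicalContraction O) (hN : ∀ P Q, D.N (e P) (e Q) = e (D.N P Q))
  (hM : ∀ P Q, D.M (e P) (e Q) = e (D.M P Q)) (hR : ∀ P, D.R (e P) = e (D.R P))

include hN hM hR

theorem moved_orderIso (x : Y) : D.moved v (e P) t (e x) = D.moved w P t x := by
  classical
  rw [moved, moved, ← Equiv.sum_comp e.toEquiv]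
  simp [hvw, hN, hM, hR, moveLow_orderIso e hvw, moveUp_orderIso e hvw, massAbove_orderIso e hvw]

theorem deform_orderIso (hO : ∀ P, e P ∈ O ↔ P ∈ O) (x : Y) :
    D.deform v s (e x) = D.deform w s x := by
  classical
  rw [deform, deform, ← Equiv.sum_comp e.toEquiv]
  simp [hvw, hO, moved_orderIso e hvw D hN hM hR]

end ConicalContraction

end Equivariance

/-- The action of an element of `G` on a `G`-poset, as an order isomorphism. -/
def smulOrderIso {G : Type*} [Group G] (Y : Type*) [PartialOrder Y] [MulAction G Y]
    [CovariantClass G Y (· • ·) (· ≤ ·)] (g : G) : Y ≃o Y where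
  toEquiv := MulAction.toPerm g
  map_rel_iff' {a b} := by
    refine ⟨fun h => ?_, fun h => (smulOrderHom Y g).monotone h⟩
    have h' : g⁻¹ • g • a ≤ g⁻¹ • g • b := (smulOrderHom Y g⁻¹).monotone h
    rwa [inv_smul_smul, inv_smul_smul] at h'


/-! ### The deformation as a continuous equivariant homotopy -/

namespace ConicalContraction

variable {Y : Type*} [PartialOrder Y] [Fintype Y] {O : Set Y} (D : ConicalContraction O)

theorem continuous_moved (P x : Y) :
    Continuous fun q : ℝ × (Y → ℝ) => D.moved q.2 P q.1 x := by
  have hA : ∀ Q, Continuous fun q : ℝ × (Y → ℝ) => massAbove q.2 Q := fun Q =>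
    (continuous_massAbove Q).comp continuous_snd
  have hL : ∀ Q, Continuous fun q : ℝ × (Y → ℝ) => moveLow q.2 P q.1 Q := fun Q =>
    continuous_transfer (by fun_prop)
      (continuous_fst.sub ((continuous_massBetween P Q).comp continuous_snd))
  have hU : ∀ Q, Continuous fun q : ℝ × (Y → ℝ) => moveUp q.2 (q.1 - massAbove q.2 P) Q :=
    fun Q => continuous_transfer (by fun_prop) ((continuous_fst.sub (hA P)).sub (hA Q))
  unfold moved
  refine Continuous.add (continuous_finsetSum _ fun Q _ => ?_) ?_
  · by_cases h : P < Q
    · simp only [if_pos h]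
      refine Continuous.add (Continuous.add ?_ ?_) ?_ <;> split_ifs <;> fun_prop
    · simp only [if_neg h]
      fun_prop
  · split_ifs <;> fun_prop

/-- Summing over all of `O`, instead of selecting the occupied `P`, gives one continuous formula on
the whole space. -/
theorem continuous_deform (x : Y) : Continuous fun q : ℝ × (Y → ℝ) => D.deform q.2 q.1 x := by
  unfold deform
  refine Continuous.add (by fun_prop) (continuous_finsetSum _ fun P _ => ?_)
  by_cases h : P ∈ O
  · simp only [if_pos h]
    refine Continuous.sub (Continuous.sub ?_ ?_) ?_
    · exact (D.continuous_moved P x).comp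
        (f := fun q : ℝ × (Y → ℝ) => (q.1 * q.2 P, q.2)) (by fun_prop)
    · split_ifs <;> fun_prop
    · split_ifs <;> fun_prop
  · simp only [if_neg h]
    fun_prop

/-- The deformation of `|Y|` that pushes an antichain `O` off `Y` along conical contractions of the
upper links of its elements. -/
def deformation (hO : IsAntichain (· ≤ ·) O) (q : unitInterval × Realization Y) : Realization Y :=
  Realization.ofWeights (D.deform q.2.coord q.1)
    (D.deform_nonneg q.2.coord_nonneg q.2.isChain_coord hO q.1.2.2)
    (D.sum_deform_pos q.2.coord_nonneg q.2.sum_coord q.2.isChain_coord hO q.1.2.2)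
    (D.isChain_deform q.2.coord_nonneg q.2.isChain_coord hO)

theorem coord_deformation (hO : IsAntichain (· ≤ ·) O) (q : unitInterval × Realization Y) (x : Y) :
    (D.deformation hO q).coord x = D.deform q.2.coord q.1 x / ∑ y, D.deform q.2.coord q.1 y :=
  rfl

theorem continuous_deformation (hO : IsAntichain (· ≤ ·) O) : Continuous (D.deformation hO) := by
  have h : ∀ x, Continuous fun q : unitInterval × Realization Y => D.deform q.2.coord q.1 x :=
    fun x => (D.continuous_deform x).comp
      (f := fun q : unitInterval × Realization Y => ((q.1 : ℝ), q.2.coord))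
      ((continuous_subtype_val.comp continuous_fst).prodMk
        (Realization.continuous_coord.comp continuous_snd))
  refine Realization.continuous_of_coord fun x => ?_
  simp only [coord_deformation]
  exact (h x).div (continuous_finsetSum _ fun y _ => h y) fun q =>
    (D.sum_deform_pos q.2.coord_nonneg q.2.sum_coord q.2.isChain_coord hO q.1.2.2).ne'

theorem deform_time_zero {w : Y → ℝ} (hw : ∀ x, 0 ≤ w x) (x : Y) : D.deform w 0 x = w x := by
  classical
  rw [deform, Finset.sum_eq_zero, add_zero]
  intro P _
  simp [D.moved_zero hw]

theorem deformation_zero (hO : IsAntichain (· ≤ ·) O) (w : Realization Y) :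
    D.deformation hO (0, w) = w := by
  refine Realization.ext_coord fun x => ?_
  simp only [coord_deformation, Set.Icc.coe_zero, D.deform_time_zero w.coord_nonneg, w.sum_coord,
    div_one]

theorem deformation_eq (hO : IsAntichain (· ≤ ·) O) (s : unitInterval) (w : Realization Y)
    (h : ∀ P ∈ O, w.coord P = 0) : D.deformation hO (s, w) = w := by
  refine Realization.ext_coord fun x => ?_
  simp only [coord_deformation, D.deform_eq w.coord_nonneg h, w.sum_coord, div_one]

/-- At time one the occupied `P` is completely drained, and new vertices appear only strictly above
it. The induction on group orders needs this upward motion. -/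
theorem coord_deformation_one (hO : IsAntichain (· ≤ ·) O) (w : Realization Y) {x : Y}
    (hx : (D.deformation hO (1, w)).coord x ≠ 0) :
    (x ∉ O ∧ w.coord x ≠ 0) ∨ ∃ P ∈ O, w.coord P ≠ 0 ∧ P < x := by
  by_cases h : ∃ P ∈ O, w.coord P ≠ 0
  · obtain ⟨P, hP, hwP⟩ := h
    have hx' : D.deform w.coord 1 x ≠ 0 := fun h0 => hx (by
      rw [coord_deformation, Set.Icc.coe_one, h0, zero_div])
    rcases D.deform_ne_zero w.coord_nonneg w.isChain_coord hO hP hwP hx' with ⟨h1, h2, h3⟩ | h1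
    · exact Or.inl ⟨fun hxO => h3 rfl (hO.eq hxO hP h2), h1⟩
    · exact Or.inr ⟨P, hP, hwP, D.lt_of_moved_ne_zero hP h1⟩
  · push Not at h
    rw [D.deformation_eq hO 1 w h] at hx
    exact Or.inl ⟨fun hxO => hx (h x hxO), hx⟩

variable {G : Type*} [Group G] [MulAction G Y] [CovariantClass G Y (· • ·) (· ≤ ·)]

theorem deformation_smul (hO : IsAntichain (· ≤ ·) O) (hOG : ∀ (g : G), ∀ P ∈ O, g • P ∈ O)
    (hN : ∀ (g : G) P Q, D.N (g • P) (g • Q) = g • D.N P Q)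
    (hM : ∀ (g : G) P Q, D.M (g • P) (g • Q) = g • D.M P Q)
    (hR : ∀ (g : G) P, D.R (g • P) = g • D.R P) (g : G) (s : unitInterval) (w : Realization Y) :
    D.deformation hO (s, g • w) = g • D.deformation hO (s, w) := by
  have key : ∀ x, D.deform (g • w).coord s (g • x) = D.deform w.coord s x :=
    D.deform_orderIso (smulOrderIso Y g) (Realization.coord_smul g w) (hN g) (hM g) (hR g)
      fun P => ⟨fun h => by simpa [smulOrderIso] using hOG g⁻¹ _ h, hOG g P⟩
  refine Realization.ext_coord fun x => ?_
  obtain ⟨x, rfl⟩ := MulAction.surjective g x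
  rw [Realization.coord_smul, coord_deformation, coord_deformation, key,
    ← Equiv.sum_comp (MulAction.toPerm g)]
  simp only [MulAction.toPerm_apply, key]

end ConicalContraction

/-! ### Equivariant deformations and homotopy equivalences -/

section Homotopy

variable {G A : Type*} [Group G] [TopologicalSpace A] [MulAction G A]

theorem GHomotopic.refl {B : Type*} [TopologicalSpace B] [MulAction G B] {f : C(A, B)}
    (hf : ∀ (g : G) a, f (g • a) = g • f a) : GHomotopic G f f :=
  ⟨.refl f, fun g _ a => hf g a⟩

theorem GHomotopic.symm {B : Type*} [TopologicalSpace B] [MulAction G B] {f₀ f₁ : C(A, B)}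
    (h : GHomotopic G f₀ f₁) : GHomotopic G f₁ f₀ := by
  obtain ⟨F, hF⟩ := h
  exact ⟨F.symm, fun g t a => hF g (unitInterval.symm t) a⟩

theorem GHomotopic.trans {B : Type*} [TopologicalSpace B] [MulAction G B] {f₀ f₁ f₂ : C(A, B)}
    (h₁ : GHomotopic G f₀ f₁) (h₂ : GHomotopic G f₁ f₂) : GHomotopic G f₀ f₂ := by
  obtain ⟨F, hF⟩ := h₁
  obtain ⟨F', hF'⟩ := h₂
  refine ⟨F.trans F', fun g t a => ?_⟩
  rw [ContinuousMap.Homotopy.trans_apply, ContinuousMap.Homotopy.trans_apply]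
  split_ifs
  · exact hF g _ a
  · exact hF' g _ a

/-- An equivariant self-map that is equivariantly homotopic to the identity. -/
def IsGDeformation (G : Type*) {A : Type*} [Group G] [TopologicalSpace A] [MulAction G A]
    (r : C(A, A)) : Prop :=
  (∀ (g : G) a, r (g • a) = g • r a) ∧ GHomotopic G (ContinuousMap.id A) r

theorem IsGDeformation.comp {r r' : C(A, A)} (h' : IsGDeformation G r') (h : IsGDeformation G r) :
    IsGDeformation G (r'.comp r) := by
  refine ⟨fun g a => ?_, h.2.trans ?_⟩
  · rw [ContinuousMap.comp_apply, h.1, h'.1, ContinuousMap.comp_apply]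
  · obtain ⟨F, hF⟩ := h'.2
    refine ⟨(F.compContinuousMap r).cast (ContinuousMap.id_comp r) rfl, fun g t a => ?_⟩
    change F (t, r (g • a)) = g • F (t, r a)
    rw [h.1, hF]

variable {Y : Type*} [PartialOrder Y] [Fintype Y] [MulAction G Y]
  [CovariantClass G Y (· • ·) (· ≤ ·)]

/-- An invariant antichain whose elements have equivariantly conically contractible upper links can
be removed from a `G`-poset by an equivariant deformation. -/
theorem ConicalContraction.exists_isGDeformation {O : Set Y} (D : ConicalContraction O)
    (hO : IsAntichain (· ≤ ·) O) (hOG : ∀ (g : G), ∀ P ∈ O, g • P ∈ O)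
    (hN : ∀ (g : G) P Q, D.N (g • P) (g • Q) = g • D.N P Q)
    (hM : ∀ (g : G) P Q, D.M (g • P) (g • Q) = g • D.M P Q)
    (hR : ∀ (g : G) P, D.R (g • P) = g • D.R P) :
    ∃ r : C(Realization Y, Realization Y), IsGDeformation G r ∧
      (∀ w, (∀ P ∈ O, w.coord P = 0) → r w = w) ∧
      ∀ w x, (r w).coord x ≠ 0 → (x ∉ O ∧ w.coord x ≠ 0) ∨ ∃ P ∈ O, w.coord P ≠ 0 ∧ P < x := by
  let r : C(Realization Y, Realization Y) :=
    ⟨fun w => D.deformation hO (1, w), (D.continuous_deformation hO).comp (by fun_prop)⟩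
  refine ⟨r, ⟨fun g w => D.deformation_smul hO hOG hN hM hR g 1 w,
    ⟨⟨⟨D.deformation hO, D.continuous_deformation hO⟩, D.deformation_zero hO, fun _ => rfl⟩,
      fun g t w => D.deformation_smul hO hOG hN hM hR g t w⟩⟩,
    fun w h => D.deformation_eq hO 1 w h, fun w x hx => D.coord_deformation_one hO w hx⟩

/-- A full embedding of `G`-posets is a `G`-homotopy equivalence if its target has an equivariant
deformation that fixes its image and has values in the image. -/
theorem isGHomotopyEquiv_of_isGDeformation {X : Type*} [PartialOrder X] [Fintype X] [MulAction G X]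
    [CovariantClass G X (· • ·) (· ≤ ·)] (f : X →o Y) (hf : ∀ x x', f x ≤ f x' → x ≤ x')
    (hfG : ∀ (g : G) x, f (g • x) = g • f x) {r : C(Realization Y, Realization Y)}
    (hr : IsGDeformation G r)
    (hfix : ∀ w, (∀ y ∉ Set.range f, w.coord y = 0) → r w = w)
    (himage : ∀ w, ∀ y ∉ Set.range f, (r w).coord y = 0) :
    IsGHomotopyEquiv G (Realization.map f) := by
  have hinj : Function.Injective f := fun x y h => le_antisymm (hf _ _ h.le) (hf _ _ h.ge)
  have hequiv : ∀ (g : G) (w : Realization X),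
      Realization.map f (g • w) = g • Realization.map f w := by
    intro g w
    change Realization.map f (Realization.map (smulOrderHom X g) w) =
      Realization.map (smulOrderHom Y g) (Realization.map f w)
    rw [Realization.map_map, Realization.map_map]
    congr 2
    exact OrderHom.ext _ _ (funext (hfG g))
  -- Injectivity of |f| reduces the identities required of the inverse `h` to properties of `r`,
  -- since |f| ∘ h = r.
  have hmapinj : ∀ v w, Realization.map f v = Realization.map f w → v = w := fun v w h =>
    Realization.ext_coord fun x => by
      rw [← Realization.coord_map_of_injective f hinj, h, Realization.coord_map_of_injective f hinj]
  have hsum : ∀ w : Realization Y, ∑ x, (r w).coord (f x) = 1 := by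
    intro w
    rw [← (r w).sum_coord]
    exact Fintype.sum_of_injective f hinj _ _ (himage w) fun _ => rfl
  -- `h w` is `r w` read in the coordinates of `X`; by `hsum` the normalization in `ofWeights`
  -- divides by one.
  let h : C(Realization Y, Realization X) :=
    ⟨fun w => Realization.ofWeights (fun x => (r w).coord (f x)) (fun x => (r w).coord_nonneg _)
      (by rw [hsum]; exact one_pos) fun x hx y hy _ =>
        ((r w).isChain_coord.total hx hy).imp (hf _ _) (hf _ _), by
      refine Realization.continuous_of_coord fun x => ?_
      refine ((continuous_apply (f x)).comp
        (Realization.continuous_coord.comp r.continuous)).congr fun w => ?_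
      change _ = (r w).coord (f x) / _
      rw [hsum, div_one]
      rfl⟩
  have hh : ∀ w, Realization.map f (h w) = r w := by
    intro w
    refine Realization.ext_coord fun y => ?_
    by_cases hy : y ∈ Set.range f
    · obtain ⟨x, rfl⟩ := hy
      rw [Realization.coord_map_of_injective f hinj]
      change (r w).coord (f x) / _ = _
      rw [hsum, div_one]
    · rw [himage w y hy, Realization.coord_map_eq_zero f _ fun x hx => hy ⟨x, hx⟩]
  have hG : ∀ (g : G) b, h (g • b) = g • h b := fun g b => hmapinj _ _ (by
    rw [hh, hequiv, hh, hr.1])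
  have hhf : h.comp (Realization.map f) = ContinuousMap.id _ := by
    ext1 w
    refine hmapinj _ _ ?_
    rw [ContinuousMap.comp_apply, hh, ContinuousMap.id_apply]
    exact hfix _ fun y hy => Realization.coord_map_eq_zero f _ fun x hx => hy ⟨x, hx⟩
  refine ⟨hequiv, h, hG, ?_, ?_⟩
  · rw [hhf]
    exact GHomotopic.refl fun _ _ => rfl
  · have : (Realization.map f).comp h = r := ContinuousMap.ext hh
    rw [this]
    exact hr.2.symm

end Homotopy

/-! ### Contracting upper links in the Brown collection -/

section BrownCollection

variable {G : Type*} [Group G] {p : ℕ}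

/-- Upward closure keeps the whole zigzag over `P` inside the collection. -/
theorem mem_tilde_of_le {P K : Subgroup G} (hP : P ∈ (brown p G).tilde.carrier)
    (hK : IsPGroup p K) (hPK : P ≤ K) : K ∈ (brown p G).tilde.carrier := by
  obtain ⟨⟨-, hP1⟩, z, hz, hz'⟩ := hP
  exact ⟨⟨hK, fun h => hP1 (le_bot_iff.1 (h ▸ hPK))⟩, z, hPK hz, hz'⟩

open Classical in
/-- The subgroup `K` as a member of the collection, if it is a `p`-group that contains `P`. -/
def enlarge (P : (brown p G).tilde.Elem) (K : Subgroup G) : (brown p G).tilde.Elem :=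
  -- The default value `P` makes the function equivariant in all cases, not only for `p`-groups
  -- above `P`.
  if h : IsPGroup p K ∧ P.1 ≤ K then ⟨K, mem_tilde_of_le P.2 h.1 h.2⟩ else P

theorem enlarge_eq {P : (brown p G).tilde.Elem} {K : Subgroup G} (hK : IsPGroup p K)
    (hPK : P.1 ≤ K) : (enlarge P K).1 = K := by
  rw [enlarge, dif_pos ⟨hK, hPK⟩]

theorem enlarge_smul (g : G) (P : (brown p G).tilde.Elem) (K : Subgroup G) :
    enlarge (g • P) (MulAut.conj g • K) = g • enlarge P K := by
  have hval : ∀ Q : (brown p G).tilde.Elem, (g • Q).1 = MulAut.conj g • Q.1 := fun _ => rfl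
  have hp : IsPGroup p (MulAut.conj g • K : Subgroup G) ↔ IsPGroup p K :=
    ⟨fun h => by
      have := isPGroup_conj h g⁻¹
      rwa [map_inv, inv_smul_smul] at this, fun h => isPGroup_conj h g⟩
  by_cases h : IsPGroup p K ∧ P.1 ≤ K
  · refine Subtype.ext ?_
    rw [hval, enlarge_eq h.1 h.2, enlarge_eq (hp.2 h.1)]
    rw [hval]
    exact Subgroup.pointwise_smul_le_pointwise_smul_iff.2 h.2
  · have h' : ¬(IsPGroup p (MulAut.conj g • K : Subgroup G) ∧ (g • P).1 ≤ MulAut.conj g • K) := by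
      rwa [hp, hval, Subgroup.pointwise_smul_le_pointwise_smul_iff]
    rw [enlarge, dif_neg h', enlarge, dif_neg h]

/-- The members `P` of order `k` of the collection of `p`-subgroups containing a `p`-central element
for which `P̂ = 1`. -/
def undistinguished (p : ℕ) (G : Type*) [Group G] (k : ℕ) : Set (brown p G).tilde.Elem :=
  {P | P.1 ∉ (brown p G).hat.carrier ∧ Nat.card P.1 = k}

theorem smul_mem_undistinguished (k : ℕ) (g : G) (P : (brown p G).tilde.Elem)
    (hP : P ∈ undistinguished p G k) : g • P ∈ undistinguished p G k := by
  have hval : (g • P).1 = MulAut.conj g • P.1 := rfl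
  refine ⟨fun h => hP.1 ?_, ?_⟩
  · have := (brown p G).hat.conj_mem g⁻¹ _ h
    rwa [hval, map_inv, inv_smul_smul] at this
  · rw [hval, ← hP.2]
    exact (Nat.card_congr (Subgroup.equivSMul (MulAut.conj g) P.1).toEquiv).symm

theorem isPGroup_inf_normalizer_sup_radicalOf {P Q : Subgroup G} (hQ : IsPGroup p Q) :
    IsPGroup p (Q ⊓ Subgroup.normalizer (P : Set G) ⊔
      radicalOf p (Subgroup.normalizer (P : Set G)) : Subgroup G) :=
  hQ.to_inf_left.to_sup_of_normal_right' (isPGroup_radicalOf p _)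
    (inf_le_right.trans (le_normalizer_radicalOf _))

variable [Finite G]

theorem card_lt_card {P Q : Subgroup G} (h : P < Q) : Nat.card P < Nat.card Q :=
  not_le.1 fun hc => h.ne (Subgroup.eq_of_le_of_card_ge h.le hc)

theorem isAntichain_undistinguished (k : ℕ) : IsAntichain (· ≤ ·) (undistinguished p G k) := by
  intro P hP Q hQ hne hle
  exact (card_lt_card (lt_of_le_of_ne hle fun h => hne (Subtype.ext h))).ne (hP.2.trans hQ.2.symm)

variable [Fact p.Prime]

/-- The contraction `Q ≥ N_Q(P) ≤ N_Q(P) O_p(N_G(P)) ≥ O_p(N_G(P))` of the `p`-subgroups `Q > P`. -/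
def normalizerContraction (hG : HasParabolicCharacteristic p G) (k : ℕ) :
    ConicalContraction (undistinguished p G k) :=
  have hN : ∀ P Q : (brown p G).tilde.Elem, P ≤ Q →
      (enlarge P (Q.1 ⊓ Subgroup.normalizer (P.1 : Set G))).1 =
        Q.1 ⊓ Subgroup.normalizer (P.1 : Set G) := fun P Q h =>
    enlarge_eq Q.2.1.1.to_inf_left (le_inf h Subgroup.le_normalizer)
  have hM : ∀ P Q : (brown p G).tilde.Elem, P ≤ Q →
      (enlarge P (Q.1 ⊓ Subgroup.normalizer (P.1 : Set G) ⊔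
        radicalOf p (Subgroup.normalizer (P.1 : Set G)))).1 =
        Q.1 ⊓ Subgroup.normalizer (P.1 : Set G) ⊔
          radicalOf p (Subgroup.normalizer (P.1 : Set G)) := fun P Q h =>
    enlarge_eq (isPGroup_inf_normalizer_sup_radicalOf Q.2.1.1)
      ((le_inf h Subgroup.le_normalizer).trans le_sup_left)
  have hR : ∀ P : (brown p G).tilde.Elem,
      (enlarge P (radicalOf p (Subgroup.normalizer (P.1 : Set G)))).1 =
        radicalOf p (Subgroup.normalizer (P.1 : Set G)) := fun P =>
    enlarge_eq (isPGroup_radicalOf p _) (le_radicalOf_normalizer P.2.1.1)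
  { N P Q := enlarge P (Q.1 ⊓ Subgroup.normalizer (P.1 : Set G))
    M P Q := enlarge P (Q.1 ⊓ Subgroup.normalizer (P.1 : Set G) ⊔
      radicalOf p (Subgroup.normalizer (P.1 : Set G)))
    R P := enlarge P (radicalOf p (Subgroup.normalizer (P.1 : Set G)))
    lt_N P _ Q h := by
      rw [← Subtype.coe_lt_coe, hN P Q h.le]
      exact lt_inf_normalizer Q.2.1.1 h
    N_le P _ Q h := by
      rw [← Subtype.coe_le_coe, hN P Q h.le]
      exact inf_le_left
    N_le_M P _ Q h := by
      rw [← Subtype.coe_le_coe, hN P Q h.le, hM P Q h.le]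
      exact le_sup_left
    R_le_M P _ Q h := by
      rw [← Subtype.coe_le_coe, hR P, hM P Q h.le]
      exact le_sup_right
    lt_R P hP := by
      rw [← Subtype.coe_lt_coe, hR P]
      -- Equality would make `P` distinguished, because its radical always is.
      refine lt_of_le_of_ne (le_radicalOf_normalizer P.2.1.1) fun h => hP.1 ?_
      have := radicalOf_mem_hat hG P.2
      rwa [← h] at this
    N_mono P _ Q Q' h h' := by
      rw [← Subtype.coe_le_coe, hN P Q h.le, hN P Q' (h.le.trans h')]
      exact inf_le_inf_right _ h'
    M_mono P _ Q Q' h h' := by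
      rw [← Subtype.coe_le_coe, hM P Q h.le, hM P Q' (h.le.trans h')]
      exact sup_le_sup_right (inf_le_inf_right _ h') _ }

theorem exists_isGDeformation_undistinguished (hG : HasParabolicCharacteristic p G) (k : ℕ) :
    ∃ r : C(Realization (brown p G).tilde.Elem, Realization (brown p G).tilde.Elem),
      IsGDeformation G r ∧
      (∀ w, (∀ P ∈ undistinguished p G k, w.coord P = 0) → r w = w) ∧
      ∀ w x, (r w).coord x ≠ 0 → (x ∉ undistinguished p G k ∧ w.coord x ≠ 0) ∨
        ∃ P ∈ undistinguished p G k, w.coord P ≠ 0 ∧ P < x := by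
  have hval : ∀ (g : G) (Q : (brown p G).tilde.Elem), (g • Q).1 = MulAut.conj g • Q.1 :=
    fun _ _ => rfl
  refine (normalizerContraction hG k).exists_isGDeformation (isAntichain_undistinguished k)
    (smul_mem_undistinguished k) (fun g P Q => ?_) (fun g P Q => ?_) fun g P => ?_
  all_goals
    refine Eq.trans ?_ (enlarge_smul g P _)
    simp only [normalizerContraction, hval, normalizer_smul, radicalOf_smul, Subgroup.smul_inf,
      Subgroup.smul_sup]

/-- Induction on `k`, composing with the deformation that clears order `k`. That deformation creates
mass only at groups strictly containing one of order `k`, so smaller orders remain cleared. -/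
theorem exists_isGDeformation_card_lt (hG : HasParabolicCharacteristic p G) (k : ℕ) :
    ∃ r : C(Realization (brown p G).tilde.Elem, Realization (brown p G).tilde.Elem),
      IsGDeformation G r ∧
      (∀ w, (∀ P : (brown p G).tilde.Elem, P.1 ∉ (brown p G).hat.carrier → w.coord P = 0) →
        r w = w) ∧
      ∀ w, ∀ P : (brown p G).tilde.Elem, P.1 ∉ (brown p G).hat.carrier → Nat.card P.1 < k →
        (r w).coord P = 0 := by
  induction k with
  | zero =>
    exact ⟨ContinuousMap.id _, ⟨fun _ _ => rfl, GHomotopic.refl fun _ _ => rfl⟩, fun _ _ => rfl,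
      fun _ _ _ h => (Nat.not_lt_zero _ h).elim⟩
  | succ k ih =>
    obtain ⟨r, hr, hfix, him⟩ := ih
    obtain ⟨r', hr', hfix', him'⟩ := exists_isGDeformation_undistinguished hG k
    refine ⟨r'.comp r, hr'.comp hr, fun w hw => ?_, fun w P hP hk => ?_⟩
    · rw [ContinuousMap.comp_apply, hfix w hw, hfix' w fun P hP => hw P hP.1]
    · by_contra hne
      rcases him' (r w) P hne with ⟨h1, h2⟩ | ⟨Q, hQ, -, hlt⟩
      · refine h2 (him w P hP (lt_of_le_of_ne (Nat.lt_succ_iff.1 hk) fun h => h1 ⟨hP, h⟩))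
      · have h1 := card_lt_card (show Q.1 < P.1 from hlt)
        rw [hQ.2] at h1
        omega

end BrownCollection

end PSubgroupCollections

end

theorem proposition3p8 {G : Type*} [Group G] [Finite G] (p : ℕ) [Fact p.Prime]
    (hG : PSubgroupCollections.HasParabolicCharacteristic p G) :
    PSubgroupCollections.IsGHomotopyEquiv G
      (PSubgroupCollections.Realization.map
        (PSubgroupCollections.PCollection.inclusion
          (PSubgroupCollections.PCollection.hat_subset_tilde
            (PSubgroupCollections.brown p G)))) := by
  -- The bound on orders is strict, so `Nat.card G + 1` covers every subgroup, including `G` itself.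
  obtain ⟨r, hr, hfix, him⟩ :=
    PSubgroupCollections.exists_isGDeformation_card_lt hG (Nat.card G + 1)
  have hrange : ∀ P : (PSubgroupCollections.brown p G).tilde.Elem,
      P ∉ Set.range (PSubgroupCollections.PCollection.inclusion
        (PSubgroupCollections.PCollection.hat_subset_tilde (PSubgroupCollections.brown p G))) ↔
      P.1 ∉ (PSubgroupCollections.brown p G).hat.carrier := fun P =>
    not_congr ⟨fun ⟨Q, hQ⟩ => hQ ▸ Q.2, fun h => ⟨⟨P.1, h⟩, rfl⟩⟩
  refine PSubgroupCollections.isGHomotopyEquiv_of_isGDeformation _ (fun _ _ h => h)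
    (fun _ _ => rfl) hr (fun w hw => hfix w fun P hP => hw P ((hrange P).2 hP)) fun w P hP =>
    him w P ((hrange P).1 hP) (Nat.lt_succ_iff.2 ?_)
  exact Nat.le_of_dvd Nat.card_pos (Subgroup.card_subgroup_dvd_card P.1)
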